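/- For real $a$ and $b>0$ let $M(a,b,z)=\sum_{k\ge0}\frac{(a)_k}{(b)_k\,k!}z^k$ be Kummer's function, and for real $a,b$ and $z>0$ let $U(a,b,z)$ be Tricomi's function, i.e. the solution of $zg''+(b-z)g'-ag=0$ on $(0,\infty)$ with $z^aU(a,b,z)\to1$ as $z\to\infty$. For $\varepsilon>0$ put $c(s)=s^+-\varepsilon s^-$, where $s^\pm=\max(\pm s,0)$ (that is, $a_+=1$ and $a_-=\varepsilon$). Theorem. Let $n\ge3$. There are $\varepsilon_0=\varepsilon_0(n)\in(0,1)$ and, for every $\varepsilon\in(0,\varepsilon_0)$, an exponent $\alpha=\alpha(n,\varepsilon)\in(0,1)$ such that the following holds. 1. The functions $s\mapsto M(-\frac\alpha2,\frac n2,\frac{s^2}4)$ and $s\mapsto U(-\frac\alpha2,\frac n2,\frac{\varepsilon s^2}4)$ each have exactly one zero in $(0,\infty)$, and these two zeros are equal; call the common zero $s_\varepsilon$. 2. There is a constant $\kappa>0$ such that the function $$f(s)=\begin{cases}M(-\frac\alpha2,\frac n2,\frac{s^2}4), & 0\le s\le s_\varepsilon,\\ -\kappa\, U(-\frac\alpha2,\frac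 n2,\frac{\varepsilon s^2}4), & s>s_\varepsilon,\end{cases}$$ is $C^1$ on $[0,\infty)$, satisfies $f(0)=1$ and $f'(0)=0$, has $s^{-\alpha}f(s)$ bounded as $s\to\infty$, and solves, for $s>0$, $f''+(\frac{n-1}s-\frac s2)f'+\frac\alpha2f=0$ where $f>0$ and $f''+(\frac{n-1}s-\frac{\varepsilon s}2)f'+\frac{\varepsilon\alpha}2f=0$ where $f<0$. 3. The self-similar function $u(x,t)=(-t)^{\alpha/2}f\big(|x|/\sqrt{-t}\big)$ solves $\partial_tc(u)-\Delta u=0$ in $\mathbb R^n\times(-\infty,0)$ in both of the following senses. It is a continuous weak solution: it has a locally square integrable weak spatial gradient, and $\iint\big(c(u)\,\partial_t\varphi-\nabla u\cdot\nabla\varphi\big)\,dx\,dt=0$ for all $\varphi\in C_c^\infty(\mathbb R^n\times(-\infty,0))$. It is also a classical solution of the free transmission problem: it is $C^2$ in $(x,t)$ with $\partial_tu=\Delta u$ where $u>0$, it is $C^2$ in $(x,t)$ with $\varepsilon\,\partial_tu=\Delta u$ where $u<0$, and at each point of $\{u=0\}$ the limits of $\nabla u$ taken from the two phases exist and agree.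 4. The function $u$ is not Lipschitz in space near the origin: for every $r>0$ there is no $L$ such that $|u(x,t)-u(y,t)|\le L|x-y|$ for all $|x|,|y|<r$ and $-r^2<t<0$. Moreover, for fixed $n$, $\alpha(n,\varepsilon)\to0$ as $\varepsilon\to0^+$. -/

import Mathlib

open Set Filter Topology MeasureTheory
open scoped ContDiff

/-! ## Confluent hypergeometric functions of a real variable -/

/-- Kummer's function `M(a,b,z) = ∑ (a)_k / ((b)_k k!) z^k`, where `(a)_k = a(a+1)⋯(a+k-1)`. -/
noncomputable def kummerM (a b z : ℝ) : ℝ :=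
  ∑' k : ℕ, (ascPochhammer ℝ k).eval a / ((ascPochhammer ℝ k).eval b * (k.factorial : ℝ)) * z ^ k

/-- `tricomiAux k a b z` is Tricomi's `U(a,b,z)` for `z > 0`, whenever `a + k > 0`.
For `k = 0` it is the integral representation
`U(a,b,z) = Γ(a)⁻¹ ∫₀^∞ e^{-zt} t^{a-1} (1+t)^{b-a-1} dt`, valid for `a > 0`;
each further step uses the contiguous relation
`U(a,b,z) = z U(a+1,b+1,z) - (b-a-1) U(a+1,b,z)`
(one integration by parts in the integral), which continues `U` analytically to smaller `a`. -/
noncomputable def tricomiAux : ℕ → ℝ → ℝ → ℝ → ℝ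
  | 0, a, b, z =>
      (Real.Gamma a)⁻¹ *
        ∫ t in Ioi (0 : ℝ), Real.exp (-(z * t)) * t ^ (a - 1) * (1 + t) ^ (b - a - 1)
  | k + 1, a, b, z =>
      z * tricomiAux k (a + 1) (b + 1) z - (b - a - 1) * tricomiAux k (a + 1) b z

/-- Tricomi's function `U(a,b,z)` for real `a`, `b` and `z > 0`: the solution of
`z g'' + (b - z) g' - a g = 0` on `(0,∞)` with `z^a U(a,b,z) → 1` as `z → ∞`.
The number of steps `⌊1 - a⌋₊` is the least `k` with `a + k > 0`. -/
noncomputable def tricomiU (a b z : ℝ) : ℝ := tricomiAux ⌊1 - a⌋₊ a b z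

/-- `s₀` is the unique positive zero of `g`. -/
def IsUniquePosZero (g : ℝ → ℝ) (s₀ : ℝ) : Prop :=
  0 < s₀ ∧ g s₀ = 0 ∧ ∀ s : ℝ, 0 < s → g s = 0 → s = s₀

/-! ## The parabolic free transmission problem `∂ₜ c(u) - Δ u = 0` -/

/-- Space-time `ℝⁿ × ℝ`; the second component is time. -/
abbrev SpaceTime (n : ℕ) : Type := EuclideanSpace ℝ (Fin n) × ℝ

/-- `c(s) = a₊ s⁺ - a₋ s⁻`. -/
def phaseC (aP aM s : ℝ) : ℝ := aP * max s 0 - aM * max (-s) 0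

/-- The gradient of `u` in the space variable. -/
noncomputable def spaceGrad {n : ℕ} (u : SpaceTime n → ℝ) (p : SpaceTime n) :
    EuclideanSpace ℝ (Fin n) :=
  gradient (fun y => u (y, p.2)) p.1

/-- The Laplacian of `u` in the space variable. -/
noncomputable def spaceLaplacian {n : ℕ} (u : SpaceTime n → ℝ) (p : SpaceTime n) : ℝ :=
  Laplacian.laplacian (fun y => u (y, p.2)) p.1

/-- The derivative of `u` in the time variable. -/
noncomputable def timeDeriv {n : ℕ} (u : SpaceTime n → ℝ) (p : SpaceTime n) : ℝ :=
  deriv (fun τ => u (p.1, τ)) p.2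

/-- Test functions `φ ∈ C_c^∞(Ω)`. -/
def IsTestFunction {n : ℕ} (Ω : Set (SpaceTime n)) (φ : SpaceTime n → ℝ) : Prop :=
  ContDiff ℝ ∞ φ ∧ HasCompactSupport φ ∧ tsupport φ ⊆ Ω

/-- `G` is the weak gradient of `u` in the space variable on the open set `Ω`,
and it is locally square integrable. -/
def IsWeakSpaceGrad {n : ℕ} (Ω : Set (SpaceTime n)) (u : SpaceTime n → ℝ)
    (G : SpaceTime n → EuclideanSpace ℝ (Fin n)) : Prop :=
  (∀ K : Set (SpaceTime n), IsCompact K → K ⊆ Ω → MemLp G 2 (volume.restrict K)) ∧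
  ∀ φ : SpaceTime n → ℝ, IsTestFunction Ω φ → ∀ e : EuclideanSpace ℝ (Fin n),
    ∫ p, u p * inner ℝ (spaceGrad φ p) e = - ∫ p, inner ℝ (G p) e * φ p

/-- Continuous weak solutions of `∂ₜ c(u) - Δ u = 0` in the open set `Ω`, where
`c(s) = a₊ s⁺ - a₋ s⁻`: the weak space gradient `G` of `u` is locally square integrable and
`∬ (c(u) ∂ₜφ - G · ∇φ) = 0` for all test functions `φ`. -/
def IsWeakSolution {n : ℕ} (aP aM : ℝ) (Ω : Set (SpaceTime n)) (u : SpaceTime n → ℝ) : Prop :=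
  ContinuousOn u Ω ∧
  ∃ G : SpaceTime n → EuclideanSpace ℝ (Fin n), IsWeakSpaceGrad Ω u G ∧
    ∀ φ : SpaceTime n → ℝ, IsTestFunction Ω φ →
      ∫ p, (phaseC aP aM (u p) * timeDeriv φ p - inner ℝ (G p) (spaceGrad φ p)) = 0

/-- Classical solutions of the free transmission problem in the open set `Ω`:
`a₊ ∂ₜu = Δu` where `u > 0`, `a₋ ∂ₜu = Δu` where `u < 0`, and at the points of the free boundary
`{u = 0}` the limits of `∇u` from the two phases exist and agree (so `∂_ν u⁺ = ∂_ν u⁻`, both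
normal derivatives being taken in the inward direction of the respective phase). -/
structure IsClassicalSolution {n : ℕ} (aP aM : ℝ) (Ω : Set (SpaceTime n))
    (u : SpaceTime n → ℝ) : Prop where
  continuousOn : ContinuousOn u Ω
  pos_phase : ∀ p ∈ Ω, 0 < u p → ContDiffAt ℝ 2 u p ∧ aP * timeDeriv u p = spaceLaplacian u p
  neg_phase : ∀ p ∈ Ω, u p < 0 → ContDiffAt ℝ 2 u p ∧ aM * timeDeriv u p = spaceLaplacian u p
  transmission : ∀ p ∈ Ω, u p = 0 → ∃ G : EuclideanSpace ℝ (Fin n),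
    Tendsto (spaceGrad u) (𝓝[{q ∈ Ω | 0 < u q}] p) (𝓝 G) ∧
    Tendsto (spaceGrad u) (𝓝[{q ∈ Ω | u q < 0}] p) (𝓝 G)

/-- `u` is Lipschitz in the space variable on `A`, uniformly in time. -/
def IsSpaceLipschitzOn {n : ℕ} (A : Set (SpaceTime n)) (u : SpaceTime n → ℝ) : Prop :=
  ∃ L : ℝ, ∀ (x y : EuclideanSpace ℝ (Fin n)) (t : ℝ), (x, t) ∈ A → (y, t) ∈ A →
    |u (x, t) - u (y, t)| ≤ L * ‖x - y‖

/-! ## Self-similar solutions -/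

/-- `u(x,t) = (-t)^{α/2} f(|x| / √(-t))`, for `t < 0`. -/
noncomputable def selfSimilar (n : ℕ) (α : ℝ) (f : ℝ → ℝ) (p : SpaceTime n) : ℝ :=
  (-p.2) ^ (α / 2) * f (‖p.1‖ / √(-p.2))

/-- The profile `f = M(-α/2, n/2, s²/4)` on `[0,s₀]`, `f = -κ U(-α/2, n/2, ε s²/4)` on `(s₀,∞)`. -/
noncomputable def profile (n : ℕ) (α ε κ s₀ : ℝ) (s : ℝ) : ℝ :=
  if s ≤ s₀ then kummerM (-α / 2) ((n : ℝ) / 2) (s ^ 2 / 4)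
  else -κ * tricomiU (-α / 2) ((n : ℝ) / 2) (ε * s ^ 2 / 4)

/-- `f : [0,∞) → ℝ` is a `C¹` solution of the self-similar profile equations with `a₊ = 1`,
`a₋ = ε`, with `f(0) = 1`, `f'(0) = 0` and `s^{-α} f(s)` bounded as `s → ∞`. -/
structure IsProfileSolution (n : ℕ) (α ε : ℝ) (f : ℝ → ℝ) : Prop where
  contDiffOn : ContDiffOn ℝ 1 f (Ici 0)
  ode_pos : ∀ s : ℝ, 0 < s → 0 < f s → ∃ f₂ : ℝ, HasDerivAt (deriv f) f₂ s ∧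
    f₂ + (((n : ℝ) - 1) / s - s / 2) * deriv f s + α / 2 * f s = 0
  ode_neg : ∀ s : ℝ, 0 < s → f s < 0 → ∃ f₂ : ℝ, HasDerivAt (deriv f) f₂ s ∧
    f₂ + (((n : ℝ) - 1) / s - ε * s / 2) * deriv f s + ε * α / 2 * f s = 0
  value_zero : f 0 = 1
  deriv_zero : HasDerivWithinAt f 0 (Ici 0) 0
  bounded : (fun s : ℝ => s ^ (-α) * f s) =O[atTop] (fun _ => (1 : ℝ))

/-! ## Kummer's function -/

/-! Put w = s²/4, β = α/2 and b = n/2. Both profile equations become w F'' + (b - λw) F' + λβ F = 0,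
with λ = 1 in the positive phase and λ = ε in the negative one. `M(-β,b,w)` is the branch regular at
0; `U(-β,b,εw)` is the branch growing only like w^β. For 0 < β < 1 the first decreases strictly
through one zero k(β). The second increases in its argument, with one zero t(β) in the variable z =
εw (`tricomiW` is `U` times the positive factor Γ(1-β)).

The zeros coincide exactly when t(β)/k(β) = ε. As β → 0 both functions tend pointwise to 1, so k
eventually exceeds 1 while t → 0, and the ratio tends to 0. It is continuous in β, so every small ε
is attained, and β(ε) can be chosen tending to 0 (`exists_matching_exponent`). Since both zeros are
simple and the slopes have opposite signs, a positive multiple of -U continues M in a C¹ way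
(`isTwoPhaseProfile_glue`).

Away from the interface the profile equations are the two heat equations for u. Across it ∇u is
continuous, even locally Lipschitz, as is c(u). Integration by parts therefore leaves no interface
term, and the weak equation reduces to a pointwise identity off a null set
(`isWeakSolution_simSol`). At time -τ, u equals τ^β at the origin and vanishes at distance of order
√τ. As β < 1/2, no Lipschitz bound survives τ → 0. -/

theorem ascPochhammer_eval_succ_left (a : ℝ) (k : ℕ) :
    (ascPochhammer ℝ (k + 1)).eval a = a * (ascPochhammer ℝ k).eval (a + 1) := by
  rw [ascPochhammer_succ_left]; simp [Polynomial.eval_comp]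

theorem abs_ascPochhammer_eval_le {a b : ℝ} (h : |a| ≤ b) (k : ℕ) :
    |(ascPochhammer ℝ k).eval a| ≤ (ascPochhammer ℝ k).eval b := by
  induction k with
  | zero => simp
  | succ k ih =>
    rw [ascPochhammer_succ_eval, ascPochhammer_succ_eval, abs_mul]
    have h1 : |a + k| ≤ b + k := (abs_add_le a k).trans (by simpa using h)
    exact mul_le_mul ih h1 (abs_nonneg _) ((abs_nonneg _).trans ih)

/-- The coefficients of Kummer's series. -/
noncomputable def kummerCoeff (a b : ℝ) (k : ℕ) : ℝ :=
  (ascPochhammer ℝ k).eval a / ((ascPochhammer ℝ k).eval b * (k.factorial : ℝ))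

theorem kummerM_eq_tsum (a b z : ℝ) : kummerM a b z = ∑' k : ℕ, kummerCoeff a b k * z ^ k := rfl

/-- Under |a| ≤ b each Pochhammer ratio has modulus at most 1, so the exponential series dominates
Kummer's uniformly in a. The condition passes to (a+1, b+1), so differentiation can be iterated. -/
theorem abs_kummerCoeff_le {a b : ℝ} (hb : 0 < b) (h : |a| ≤ b) (k : ℕ) :
    |kummerCoeff a b k| ≤ 1 / (k.factorial : ℝ) := by
  have h1 := ascPochhammer_pos k b hb
  have h2 : (0 : ℝ) < k.factorial := by positivity
  rw [kummerCoeff, abs_div, abs_of_pos (mul_pos h1 h2), div_le_div_iff₀ (mul_pos h1 h2) h2, one_mul]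
  exact mul_le_mul_of_nonneg_right (abs_ascPochhammer_eval_le h k) h2.le

theorem kummerCoeff_zero (a b : ℝ) : kummerCoeff a b 0 = 1 := by simp [kummerCoeff]

theorem kummerCoeff_succ (a b : ℝ) (k : ℕ) :
    ((k : ℝ) + 1) * kummerCoeff a b (k + 1) = a / b * kummerCoeff (a + 1) (b + 1) k := by
  rw [kummerCoeff, kummerCoeff, ascPochhammer_eval_succ_left, ascPochhammer_eval_succ_left,
    Nat.factorial_succ]
  have h : ((k : ℝ) + 1) ≠ 0 := by positivity
  push_cast
  rw [div_mul_div_comm, mul_div_assoc']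
  rw [show b * Polynomial.eval (b + 1) (ascPochhammer ℝ k) * (((k : ℝ) + 1) * (k.factorial : ℝ))
    = (k + 1) * (b * (Polynomial.eval (b + 1) (ascPochhammer ℝ k) * (k.factorial : ℝ))) by ring,
    mul_div_mul_left _ _ h]

/-- This recursion is Kummer's equation read coefficient by coefficient. -/
theorem kummerCoeff_succ' {b : ℝ} (hb : 0 < b) (a : ℝ) (k : ℕ) :
    ((k : ℝ) + 1) * (b + k) * kummerCoeff a b (k + 1) = (a + k) * kummerCoeff a b k := by
  have h1 := (ascPochhammer_pos k b hb).ne'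
  have h2 : (k.factorial : ℝ) ≠ 0 := by positivity
  have h3 : b + k ≠ 0 := by positivity
  have h4 : ((k : ℝ) + 1) ≠ 0 := by positivity
  rw [kummerCoeff, kummerCoeff, ascPochhammer_succ_eval, ascPochhammer_succ_eval,
    Nat.factorial_succ]
  push_cast
  field_simp

theorem norm_kummer_term_le {a b : ℝ} (hb : 0 < b) (h : |a| ≤ b) {z R : ℝ} (hz : |z| ≤ R) (k : ℕ) :
    ‖kummerCoeff a b k * z ^ k‖ ≤ R ^ k / (k.factorial : ℝ) := by
  rw [norm_mul, norm_pow, Real.norm_eq_abs, Real.norm_eq_abs]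
  calc _ ≤ 1 / (k.factorial : ℝ) * R ^ k := by
        gcongr; exact abs_kummerCoeff_le hb h k
    _ = _ := by ring

theorem summable_kummer {a b : ℝ} (hb : 0 < b) (h : |a| ≤ b) (z : ℝ) :
    Summable fun k => kummerCoeff a b k * z ^ k :=
  Summable.of_norm_bounded (Real.summable_pow_div_factorial |z|)
    (fun k => norm_kummer_term_le hb h le_rfl k)

theorem abs_add_one_le {a b : ℝ} (h : |a| ≤ b) : |a + 1| ≤ b + 1 :=
  (abs_add_le a 1).trans (by simpa using h)

theorem hasDerivAt_kummerM {a b : ℝ} (hb : 0 < b) (h : |a| ≤ b) (z : ℝ) :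
    HasDerivAt (kummerM a b) (a / b * kummerM (a + 1) (b + 1) z) z := by
  have hb1 : 0 < b + 1 := by linarith
  have h1 := abs_add_one_le h
  have hterm : ∀ (k : ℕ) (y : ℝ), ((k + 1 : ℕ) : ℝ) * y ^ (k + 1 - 1) * kummerCoeff a b (k + 1)
      = a / b * (kummerCoeff (a + 1) (b + 1) k * y ^ k) := by
    intro k y
    rw [← mul_assoc, ← kummerCoeff_succ]
    rw [Nat.add_sub_cancel]
    push_cast
    ring
  -- Termwise differentiation on the ball of radius |z| + 1: the derived series is dominated there
  -- by its absolute values at |z| + 1, and is summable because an index shift turns it into the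
  -- series of `M(a+1,b+1,·)`.
  have key := hasDerivAt_tsum_of_isPreconnected (𝕜 := ℝ) (t := Metric.ball 0 (|z| + 1))
    (u := fun k : ℕ => ‖(k : ℝ) * (|z| + 1) ^ (k - 1) * kummerCoeff a b k‖)
    (g := fun (k : ℕ) y => kummerCoeff a b k * y ^ k)
    (g' := fun (k : ℕ) y => (k : ℝ) * y ^ (k - 1) * kummerCoeff a b k) (y₀ := z) (y := z) ?_
    Metric.isOpen_ball (convex_ball _ _).isPreconnected ?_ ?_ ?_ (summable_kummer hb h z) ?_
  · have e : (∑' k : ℕ, (k : ℝ) * z ^ (k - 1) * kummerCoeff a b k)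
        = a / b * kummerM (a + 1) (b + 1) z := by
      rw [tsum_eq_zero_add']
      · simp only [hterm, tsum_mul_left]; simp [kummerM_eq_tsum]
      · simp only [hterm]; exact (summable_kummer hb1 h1 z).mul_left _
    rw [← e]; exact key
  · rw [← summable_nat_add_iff 1]
    simp only [hterm]
    exact ((summable_kummer hb1 h1 _).mul_left _).norm
  · intro k y _
    exact ((hasDerivAt_pow k y).const_mul (kummerCoeff a b k)).congr_deriv (mul_comm _ _)
  · intro k y hy
    rw [mem_ball_zero_iff, Real.norm_eq_abs] at hy
    rw [norm_mul, norm_mul, norm_mul, norm_mul, norm_pow, norm_pow]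
    gcongr
    rw [Real.norm_eq_abs, Real.norm_eq_abs]
    exact hy.le.trans (le_abs_self _)
  · simp
  · simp

theorem hasSum_unique_zero {g : ℕ → ℝ} {S : ℝ} (h : HasSum g S) (hg : ∀ k, g k = 0) : S = 0 := by
  have : g = fun _ => 0 := funext hg
  rw [this] at h
  exact h.unique hasSum_zero

theorem kummerM_zero (a b : ℝ) : kummerM a b 0 = 1 := by
  rw [kummerM_eq_tsum, tsum_eq_single 0]
  · simp [kummerCoeff_zero]
  · intro k hk; simp [hk]

theorem contDiff_kummerM (m : ℕ) : ∀ {a b : ℝ}, 0 < b → |a| ≤ b → ContDiff ℝ m (kummerM a b) := by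
  induction m with
  | zero =>
    intro a b hb h
    exact contDiff_zero.2 (continuous_iff_continuousAt.2 fun z => (hasDerivAt_kummerM hb h z).continuousAt)
  | succ m ih =>
    intro a b hb h
    push_cast
    rw [contDiff_succ_iff_deriv]
    refine ⟨fun z => (hasDerivAt_kummerM hb h z).differentiableAt, by simp, ?_⟩
    rw [show deriv (kummerM a b) = fun z => a / b * kummerM (a + 1) (b + 1) z from
      funext fun z => (hasDerivAt_kummerM hb h z).deriv]
    exact contDiff_const.mul (ih (by linarith) (abs_add_one_le h))

/-- Kummer's equation. -/
theorem kummerM_ode {a b : ℝ} (hb : 0 < b) (h : |a| ≤ b) (z : ℝ) :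
    z * (a / b * ((a + 1) / (b + 1) * kummerM (a + 2) (b + 2) z))
      + (b - z) * (a / b * kummerM (a + 1) (b + 1) z) - a * kummerM a b z = 0 := by
  have h1 := abs_add_one_le h
  have hb1 : 0 < b + 1 := by linarith
  have h2 : |a + 2| ≤ b + 2 := by have := abs_add_one_le h1; ring_nf at this ⊢; exact this
  have hb2 : 0 < b + 2 := by linarith
  have e0 := (summable_kummer hb h z).hasSum
  have e1 := (summable_kummer hb1 h1 z).hasSum
  have e2 := (summable_kummer hb2 h2 z).hasSum
  rw [← kummerM_eq_tsum] at e0 e1 e2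
  -- Prepending a zero term absorbs the factor z, so that all four series are indexed by the power
  -- of z and cancel term by term.
  have shift : ∀ (g : ℕ → ℝ) (S : ℝ), HasSum g S → HasSum (fun k => if k = 0 then 0 else g (k - 1)) S := by
    intro g S hg
    rw [← hasSum_nat_add_iff' 1]
    simpa using hg
  have s1 := shift _ _ ((e1.mul_left (a / b)).mul_left z)
  have s2 := shift _ _ ((e2.mul_left (a / b * ((a + 1) / (b + 1)))).mul_left z)
  have tot := ((s2.add ((e1.mul_left (a / b)).mul_left b)).sub s1).sub (e0.mul_left a)
  have hzero := hasSum_unique_zero tot ?_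
  · linear_combination hzero
  · intro k
    rcases k with _ | k
    · simp [kummerCoeff_zero]; field_simp; ring
    · have r0 := kummerCoeff_succ a b k
      have r1 := kummerCoeff_succ a b (k + 1)
      have r2 := kummerCoeff_succ (a + 1) (b + 1) k
      have r3 := kummerCoeff_succ' hb a (k + 1)
      rw [show a + 1 + 1 = a + 2 by ring, show b + 1 + 1 = b + 2 by ring] at r2
      push_cast at r1 r3
      simp only [Nat.add_eq_zero_iff, one_ne_zero, and_false, if_false, Nat.add_sub_cancel]
      linear_combination (-(z * z ^ k * (a / b))) * r2 - (k + 1) * z ^ (k + 1) * r1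
        - b * z ^ (k + 1) * r1 + z * z ^ k * r0 + z ^ (k + 1) * r3

theorem continuousOn_kummerM_param {b : ℝ} (hb : 0 < b) (z : ℝ) :
    ContinuousOn (fun a => kummerM a b z) {a | |a| ≤ b} := by
  refine continuousOn_tsum (u := fun k : ℕ => |z| ^ k / (k.factorial : ℝ)) (fun k => ?_)
    (Real.summable_pow_div_factorial |z|) (fun k a ha => norm_kummer_term_le hb ha le_rfl k)
  exact (((ascPochhammer ℝ k).continuous.div_const _).mul continuous_const).continuousOn

theorem one_le_kummerM {a b z : ℝ} (ha : 0 < a) (hab : a ≤ b) (hz : 0 ≤ z) : 1 ≤ kummerM a b z := by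
  have hb := ha.trans_le hab
  have := (summable_kummer hb (by rwa [abs_of_pos ha]) z).le_tsum 0 (fun k _ => ?_)
  · simpa [kummerCoeff_zero, kummerM_eq_tsum] using this
  · have h1 := ascPochhammer_pos k b hb
    have h2 := ascPochhammer_pos k a ha
    rw [kummerCoeff]; positivity

/-- The derivative of `z ↦ M(-β, b, z)`. -/
noncomputable def kummerD (β b z : ℝ) : ℝ := -β / b * kummerM (1 - β) (b + 1) z

theorem hasDerivAt_kummerM_neg {β b : ℝ} (hb : 1 ≤ b) (h0 : 0 ≤ β) (h1 : β ≤ 1) (z : ℝ) :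
    HasDerivAt (kummerM (-β) b) (kummerD β b z) z := by
  have := hasDerivAt_kummerM (a := -β) (b := b) (by linarith)
    (by rw [abs_neg, abs_of_nonneg h0]; linarith) z
  rwa [show -β + 1 = 1 - β by ring] at this

/-- Since 1 - β > 0, the series in the derivative has positive terms and is at least its constant
term 1. The uniform negative slope yields both monotonicity and the existence of a zero. -/
theorem kummerD_le {β b z : ℝ} (hb : 1 ≤ b) (h0 : 0 < β) (h1 : β < 1) (hz : 0 ≤ z) :
    kummerD β b z ≤ -β / b := by
  have := one_le_kummerM (a := 1 - β) (b := b + 1) (z := z) (by linarith) (by linarith) hz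
  have h3 : -β / b ≤ 0 := div_nonpos_of_nonpos_of_nonneg (by linarith) (by linarith)
  rw [kummerD]; nlinarith

theorem strictAntiOn_kummerM {β b : ℝ} (hb : 1 ≤ b) (h0 : 0 < β) (h1 : β < 1) :
    StrictAntiOn (kummerM (-β) b) (Ici 0) := by
  refine strictAntiOn_of_hasDerivWithinAt_neg (convex_Ici 0)
    (fun z _ => (hasDerivAt_kummerM_neg hb h0.le h1.le z).continuousAt.continuousWithinAt)
    (fun z _ => (hasDerivAt_kummerM_neg hb h0.le h1.le z).hasDerivWithinAt) (fun z hz => ?_)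
  rw [interior_Ici] at hz
  refine (kummerD_le hb h0 h1 (le_of_lt hz)).trans_lt ?_
  exact div_neg_of_neg_of_pos (by linarith) (by linarith)

theorem exists_kummerM_zero {β b : ℝ} (hb : 1 ≤ b) (h0 : 0 < β) (h1 : β < 1) :
    ∃ z, 0 < z ∧ kummerM (-β) b z = 0 := by
  have hd := fun z => hasDerivAt_kummerM_neg (b := b) hb h0.le h1.le z
  -- Starting from the value 1 with slope at most -β/b, the function is nonpositive at b/β.
  set Z := b / β with hZ
  have hZ0 : 0 < Z := by positivity
  obtain ⟨c, hc, hc'⟩ := exists_hasDerivAt_eq_slope (kummerM (-β) b) (kummerD β b) hZ0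
    (fun z _ => (hd z).continuousAt.continuousWithinAt) (fun z _ => hd z)
  have h2 := kummerD_le hb h0 h1 hc.1.le
  rw [hc', kummerM_zero, sub_zero, div_le_iff₀ hZ0] at h2
  have h3 : -β / b * Z = -1 := by rw [hZ]; field_simp
  have := intermediate_value_Icc' hZ0.le (f := kummerM (-β) b)
    (fun z _ => (hd z).continuousAt.continuousWithinAt)
  obtain ⟨z, hz, hz'⟩ := this (show (0 : ℝ) ∈ _ by rw [kummerM_zero]; constructor <;> linarith)
  refine ⟨z, lt_of_le_of_ne hz.1 ?_, hz'⟩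
  rintro rfl
  exact one_ne_zero ((kummerM_zero _ _).symm.trans hz')

/-! ## Tricomi's function -/

/-- The integrand `e^{-zt} t^p (1+t)^q`. -/
noncomputable def tricomiIntegrand (p q z t : ℝ) : ℝ :=
  Real.exp (-(z * t)) * t ^ p * (1 + t) ^ q

/-- The integral `∫₀^∞ e^{-zt} t^p (1+t)^q dt`. -/
noncomputable def tricomiInt (p q z : ℝ) : ℝ := ∫ t in Ioi (0 : ℝ), tricomiIntegrand p q z t

theorem tricomiIntegrand_pos (p q z : ℝ) {t : ℝ} (ht : 0 < t) : 0 < tricomiIntegrand p q z t := by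
  unfold tricomiIntegrand; positivity

theorem continuousOn_tricomiIntegrand (p q z : ℝ) :
    ContinuousOn (tricomiIntegrand p q z) (Ioi 0) := by
  unfold tricomiIntegrand
  refine ((by fun_prop : Continuous fun t : ℝ => Real.exp (-(z * t))).continuousOn.mul
    (continuousOn_id.rpow_const fun t ht => Or.inl (ne_of_gt ht))).mul
    (ContinuousOn.rpow_const (by fun_prop) fun t ht => Or.inl ?_)
  have : (0 : ℝ) < t := ht
  positivity

theorem aestronglyMeasurable_tricomiIntegrand (p q z : ℝ) :
    AEStronglyMeasurable (tricomiIntegrand p q z) (volume.restrict (Ioi 0)) :=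
  (continuousOn_tricomiIntegrand p q z).aestronglyMeasurable measurableSet_Ioi

/-- Whatever the sign of q, this dominates the integrand by two Gamma integrands, with exponents p
and p + |q|. -/
theorem one_add_rpow_le {t : ℝ} (ht : 0 < t) (q : ℝ) :
    (1 + t) ^ q ≤ 2 ^ |q| * (1 + t ^ |q|) := by
  calc (1 + t) ^ q ≤ (1 + t) ^ |q| := Real.rpow_le_rpow_of_exponent_le (by linarith) (le_abs_self q)
    _ ≤ (2 * max 1 t) ^ |q| := by
        refine Real.rpow_le_rpow (by linarith) ?_ (abs_nonneg q)
        have := le_max_left 1 t; have := le_max_right 1 t; linarith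
    _ = 2 ^ |q| * (max 1 t) ^ |q| := Real.mul_rpow (by norm_num) (by positivity)
    _ ≤ _ := by
        gcongr
        rcases max_cases 1 t with ⟨h, _⟩ | ⟨h, _⟩ <;> rw [h]
        · rw [Real.one_rpow]; have := Real.rpow_nonneg ht.le |q|; linarith
        · linarith

theorem integrableOn_tricomiIntegrand {p z : ℝ} (hp : -1 < p) (q : ℝ) (hz : 0 < z) :
    IntegrableOn (tricomiIntegrand p q z) (Ioi 0) := by
  have h1 := integrableOn_rpow_mul_exp_neg_mul_rpow (p := 1) hp one_pos hz
  have h2 := integrableOn_rpow_mul_exp_neg_mul_rpow (p := 1) (s := p + |q|)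
    (by have := abs_nonneg q; linarith) one_pos hz
  refine Integrable.mono' ((h1.add h2).const_mul (2 ^ |q|))
    (aestronglyMeasurable_tricomiIntegrand p q z) ?_
  refine (ae_restrict_iff' measurableSet_Ioi).2 (Eventually.of_forall fun t ht => ?_)
  rw [mem_Ioi] at ht
  rw [Real.norm_of_nonneg (tricomiIntegrand_pos p q z ht).le]
  simp only [Pi.add_apply, Real.rpow_one, Real.rpow_add ht, neg_mul]
  calc Real.exp (-(z * t)) * t ^ p * (1 + t) ^ q
      ≤ Real.exp (-(z * t)) * t ^ p * (2 ^ |q| * (1 + t ^ |q|)) := by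
        gcongr; exact one_add_rpow_le ht q
    _ = _ := by ring

theorem tricomiInt_pos {p z : ℝ} (hp : -1 < p) (q : ℝ) (hz : 0 < z) : 0 < tricomiInt p q z := by
  refine (setIntegral_pos_iff_support_of_nonneg_ae ?_ (integrableOn_tricomiIntegrand hp q hz)).2 ?_
  · exact (ae_restrict_iff' measurableSet_Ioi).2
      (Eventually.of_forall fun t ht => (tricomiIntegrand_pos p q z ht).le)
  · refine lt_of_lt_of_le ?_ (measure_mono (s := Ioi 0) fun t ht =>
      ⟨(tricomiIntegrand_pos p q z ht).ne', ht⟩)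
    simp

theorem hasDerivAt_tricomiInt {p z : ℝ} (hp : -1 < p) (q : ℝ) (hz : 0 < z) :
    HasDerivAt (tricomiInt p q) (-tricomiInt (p + 1) q z) z := by
  have key := (hasDerivAt_integral_of_dominated_loc_of_deriv_le (μ := volume.restrict (Ioi 0))
    (F := fun z t => tricomiIntegrand p q z t) (F' := fun z t => -tricomiIntegrand (p + 1) q z t)
    -- On (z/2, ∞) the factor e^{-yt} is largest at the left endpoint.
    (bound := tricomiIntegrand (p + 1) q (z / 2)) (Ioi_mem_nhds (half_lt_self hz))
    (Eventually.of_forall fun y => aestronglyMeasurable_tricomiIntegrand p q y)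
    (integrableOn_tricomiIntegrand hp q hz)
    (aestronglyMeasurable_tricomiIntegrand (p + 1) q z).neg ?_
    (integrableOn_tricomiIntegrand (by linarith) q (half_pos hz)) ?_).2
  · rw [integral_neg] at key; exact key
  · refine (ae_restrict_iff' measurableSet_Ioi).2 (Eventually.of_forall fun t ht y hy => ?_)
    rw [norm_neg, Real.norm_of_nonneg (tricomiIntegrand_pos _ q y ht).le]
    rw [mem_Ioi] at ht hy
    unfold tricomiIntegrand
    gcongr
  · refine (ae_restrict_iff' measurableSet_Ioi).2 (Eventually.of_forall fun t ht y _ => ?_)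
    rw [mem_Ioi] at ht
    unfold tricomiIntegrand
    have h1 : HasDerivAt (fun y : ℝ => Real.exp (-(y * t))) (Real.exp (-(y * t)) * -(1 * t)) y :=
      ((hasDerivAt_id y).mul_const t).neg.exp
    refine ((h1.mul_const (t ^ p)).mul_const ((1 + t) ^ q)).congr_deriv ?_
    rw [Real.rpow_add_one ht.ne']; ring

theorem tricomiInt_add_one {p z : ℝ} (hp : -1 < p) (q : ℝ) (hz : 0 < z) :
    tricomiInt p (q + 1) z = tricomiInt p q z + tricomiInt (p + 1) q z := by
  unfold tricomiInt
  rw [← integral_add (integrableOn_tricomiIntegrand hp q hz)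
    (integrableOn_tricomiIntegrand (by linarith) q hz)]
  refine setIntegral_congr_fun measurableSet_Ioi fun t ht => ?_
  rw [mem_Ioi] at ht
  simp only [tricomiIntegrand]
  rw [Real.rpow_add_one ht.ne', Real.rpow_add_one (by positivity)]
  ring

theorem hasDerivAt_tricomiIntegrand (p q z : ℝ) {t : ℝ} (ht : 0 < t) :
    HasDerivAt (tricomiIntegrand p q z) (-z * tricomiIntegrand p q z t
      + (p * tricomiIntegrand (p - 1) q z t + q * tricomiIntegrand p (q - 1) z t)) t := by
  have h1 : HasDerivAt (fun t : ℝ => Real.exp (-(z * t))) (Real.exp (-(z * t)) * -(z * 1)) t :=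
    ((hasDerivAt_id t).const_mul z).neg.exp
  have h2 := Real.hasDerivAt_rpow_const (x := t) (p := p) (Or.inl ht.ne')
  have h3 : HasDerivAt (fun t : ℝ => (1 + t) ^ q) (1 * q * (1 + t) ^ (q - 1)) t :=
    ((hasDerivAt_id t).const_add 1).rpow_const (Or.inl (by simp; positivity))
  refine ((h1.mul h2).mul h3).congr_deriv ?_
  simp only [tricomiIntegrand, Pi.mul_apply]
  ring

theorem continuousWithinAt_tricomiIntegrand_zero {p : ℝ} (hp : 0 ≤ p) (q z : ℝ) :
    ContinuousWithinAt (tricomiIntegrand p q z) (Ici 0) 0 := by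
  unfold tricomiIntegrand
  refine ContinuousAt.continuousWithinAt ?_
  refine ((by fun_prop : Continuous fun t : ℝ => Real.exp (-(z * t))).continuousAt.mul
    (Real.continuousAt_rpow_const _ _ (Or.inr hp))).mul
    (ContinuousAt.rpow_const (by fun_prop) (Or.inl (by simp)))

/-- Integration by parts. -/
theorem mul_tricomiInt {p z : ℝ} (hp : 0 < p) (q : ℝ) (hz : 0 < z) :
    z * tricomiInt p q z = p * tricomiInt (p - 1) q z + q * tricomiInt p (q - 1) z := by
  have i1 := (integrableOn_tricomiIntegrand (p := p) (by linarith) q hz)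
  have i2 := (integrableOn_tricomiIntegrand (p := p - 1) (by linarith) q hz)
  have i3 := (integrableOn_tricomiIntegrand (p := p) (by linarith) (q - 1) hz)
  have hd := fun t ht => hasDerivAt_tricomiIntegrand p q z (t := t) ht
  have i5 : IntegrableOn (fun t => p * tricomiIntegrand (p - 1) q z t
      + q * tricomiIntegrand p (q - 1) z t) (Ioi 0) := (i2.const_mul p).add (i3.const_mul q)
  have i4 : IntegrableOn (fun t => -z * tricomiIntegrand p q z t +
      (p * tricomiIntegrand (p - 1) q z t + q * tricomiIntegrand p (q - 1) z t)) (Ioi 0) :=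
    (i1.const_mul (-z)).add i5
  have := integral_Ioi_of_hasDerivAt_of_tendsto
    (continuousWithinAt_tricomiIntegrand_zero hp.le q z) hd i4
    (tendsto_zero_of_hasDerivAt_of_integrableOn_Ioi hd i4 i1)
  rw [integral_add (i1.const_mul _) i5,
    integral_add (i2.const_mul p) (i3.const_mul q), integral_const_mul, integral_const_mul,
    integral_const_mul] at this
  simp only [tricomiIntegrand, Real.zero_rpow hp.ne'] at this
  simp only [tricomiInt, tricomiIntegrand]
  linarith

/-- At p = 0 integration by parts picks up the boundary value 1 at t = 0; this is what makes
U(0,b,z) = 1. -/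
theorem mul_tricomiInt_zero (q : ℝ) {z : ℝ} (hz : 0 < z) :
    z * tricomiInt 0 q z = 1 + q * tricomiInt 0 (q - 1) z := by
  have i1 := (integrableOn_tricomiIntegrand (p := 0) (by linarith) q hz)
  have i3 := (integrableOn_tricomiIntegrand (p := 0) (by linarith) (q - 1) hz)
  have hd : ∀ t ∈ Ioi (0 : ℝ), HasDerivAt (tricomiIntegrand 0 q z)
      (-z * tricomiIntegrand 0 q z t + q * tricomiIntegrand 0 (q - 1) z t) t := fun t ht => by
    simpa using hasDerivAt_tricomiIntegrand 0 q z (t := t) ht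
  have i4 := (i1.const_mul (-z)).add (i3.const_mul q)
  have := integral_Ioi_of_hasDerivAt_of_tendsto
    (continuousWithinAt_tricomiIntegrand_zero le_rfl q z) hd i4
    (tendsto_zero_of_hasDerivAt_of_integrableOn_Ioi hd i4 i1)
  rw [integral_add (i1.const_mul _) (i3.const_mul q), integral_const_mul, integral_const_mul] at this
  simp [tricomiIntegrand] at this
  simp only [tricomiInt, tricomiIntegrand]
  simp
  linarith

/-- The integrand is e^{-zt}(1+t)^q((1+t)/t)^β, increasing in β because (1+t)/t ≥ 1. Its value at β
= 1/2 is an integrable bound. -/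
theorem continuousOn_tricomiInt_param (q : ℝ) {z : ℝ} (hz : 0 < z) :
    ContinuousOn (fun β => tricomiInt (-β) (q + β) z) (Icc 0 (1 / 2)) := by
  refine continuousOn_of_dominated (bound := tricomiIntegrand (-(1 / 2)) (q + 1 / 2) z)
    (fun β _ => aestronglyMeasurable_tricomiIntegrand _ _ z) (fun β hβ => ?_)
    (integrableOn_tricomiIntegrand (by norm_num) _ hz) ?_
  · refine (ae_restrict_iff' measurableSet_Ioi).2 (Eventually.of_forall fun t ht => ?_)
    rw [Real.norm_of_nonneg (tricomiIntegrand_pos _ _ z ht).le]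
    rw [mem_Ioi] at ht
    have e : ∀ β : ℝ, tricomiIntegrand (-β) (q + β) z t
        = Real.exp (-(z * t)) * (1 + t) ^ q * ((1 + t) / t) ^ β := fun β => by
      rw [tricomiIntegrand, Real.rpow_neg ht.le, Real.rpow_add (by positivity),
        Real.div_rpow (by positivity) ht.le]
      field_simp
    rw [e, e]
    gcongr
    · rw [le_div_iff₀ ht]; linarith
    · exact hβ.2
  · refine (ae_restrict_iff' measurableSet_Ioi).2 (Eventually.of_forall fun t ht => ?_)
    rw [mem_Ioi] at ht
    unfold tricomiIntegrand
    refine Continuous.continuousOn ?_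
    have h1 : (1 + t) ≠ 0 := by positivity
    exact (continuous_const.mul (Continuous.rpow continuous_const continuous_neg
      fun _ => Or.inl ht.ne')).mul (Continuous.rpow continuous_const (by fun_prop) fun _ => Or.inl h1)

/-- Substitute t/z for t; then (1+t/z)^q ≤ (1+t)^q because q ≥ 0 and z ≥ 1. This is the source of
the growth bound z^β. -/
theorem tricomiInt_le {p q z : ℝ} (hp : -1 < p) (hq : 0 ≤ q) (hz : 1 ≤ z) :
    tricomiInt p q z ≤ z ^ (-p - 1) * tricomiInt p q 1 := by
  have hz0 : 0 < z := by linarith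
  have h := integral_comp_mul_left_Ioi (fun t => tricomiIntegrand p q z (z⁻¹ * t)) 0 hz0
  simp only [inv_mul_cancel_left₀ hz0.ne', mul_zero, smul_eq_mul] at h
  have h2 : ∫ t in Ioi (0 : ℝ), tricomiIntegrand p q z (z⁻¹ * t)
      ≤ ∫ t in Ioi (0 : ℝ), z ^ (-p) * tricomiIntegrand p q 1 t := by
    refine setIntegral_mono_on ?_ ((integrableOn_tricomiIntegrand hp q one_pos).const_mul _)
      measurableSet_Ioi fun t ht => ?_
    · have := (integrableOn_Ioi_comp_mul_left_iff (tricomiIntegrand p q z) 0 (inv_pos.2 hz0)).2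
        (by simpa using integrableOn_tricomiIntegrand hp q hz0)
      exact this
    · rw [mem_Ioi] at ht
      have e : z * (z⁻¹ * t) = t := by field_simp
      have h5 : z⁻¹ * t ≤ t := mul_le_of_le_one_left ht.le (inv_le_one_of_one_le₀ hz)
      have h6 : 0 < z⁻¹ * t := by positivity
      simp only [tricomiIntegrand]
      rw [e, one_mul, Real.mul_rpow (by positivity) ht.le, Real.inv_rpow hz0.le,
        ← Real.rpow_neg hz0.le]
      calc _ ≤ Real.exp (-t) * (z ^ (-p) * t ^ p) * (1 + t) ^ q := by gcongr
        _ = _ := by ring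
  rw [integral_const_mul] at h2
  rw [tricomiInt, h, sub_eq_add_neg, Real.rpow_add hz0, Real.rpow_neg_one]
  calc _ ≤ z⁻¹ * (z ^ (-p) * ∫ t in Ioi (0 : ℝ), tricomiIntegrand p q 1 t) := by gcongr
    _ = _ := by rw [tricomiInt]; ring

/-- `Γ(1-β) U(-β, b, z)` for `β < 1`. -/
noncomputable def tricomiW (β b z : ℝ) : ℝ :=
  z * tricomiInt (-β) (b - 1 + β) z - (b - 1 + β) * tricomiInt (-β) (b - 1 + β - 1) z

/-- The derivative of `z ↦ Γ(1-β) U(-β, b, z)`. -/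
noncomputable def tricomiD (β b z : ℝ) : ℝ := β * tricomiInt (-β) (b - 1 + β) z

theorem tricomiU_neg_eq {β : ℝ} (h0 : 0 ≤ β) (h1 : β < 1) (b z : ℝ) :
    tricomiU (-β) b z = (Real.Gamma (1 - β))⁻¹ * tricomiW β b z := by
  -- As 1 ≤ 1 + β < 2, exactly one contiguous step is taken.
  have hf : ⌊1 - -β⌋₊ = 1 := by
    rw [Nat.floor_eq_iff (by linarith)]; constructor <;> push_cast <;> linarith
  rw [tricomiU, hf]
  simp only [tricomiAux, tricomiW, tricomiInt, tricomiIntegrand]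
  rw [show -β + 1 - 1 = -β by ring, show b + 1 - (-β + 1) - 1 = b - 1 + β by ring,
    show b - (-β + 1) - 1 = b - 1 + β - 1 by ring, show b - -β - 1 = b - 1 + β by ring,
    show -β + 1 = 1 - β by ring]
  ring

theorem tricomiD_pos {β b z : ℝ} (h0 : 0 < β) (h1 : β < 1) (hz : 0 < z) : 0 < tricomiD β b z :=
  mul_pos h0 (tricomiInt_pos (by linarith) _ hz)

/-- Integration by parts at exponent 1 - β collapses the product-rule terms to a single integral
with factor β, whose sign is evident. -/
theorem hasDerivAt_tricomiW {β b z : ℝ} (h1 : β < 1) (hz : 0 < z) :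
    HasDerivAt (tricomiW β b) (tricomiD β b z) z := by
  have hp : -1 < -β := by linarith
  have d1 := hasDerivAt_tricomiInt hp (b - 1 + β) hz
  have d2 := hasDerivAt_tricomiInt hp (b - 1 + β - 1) hz
  refine (((hasDerivAt_id z).mul d1).sub (d2.const_mul (b - 1 + β))).congr_deriv ?_
  have := mul_tricomiInt (p := -β + 1) (by linarith) (b - 1 + β) hz
  rw [show -β + 1 - 1 = -β by ring] at this
  simp only [tricomiD, id]
  linear_combination (-1 : ℝ) * this

theorem hasDerivAt_tricomiD {β b z : ℝ} (h1 : β < 1) (hz : 0 < z) :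
    HasDerivAt (tricomiD β b) (-β * tricomiInt (1 - β) (b - 1 + β) z) z := by
  refine ((hasDerivAt_tricomiInt (by linarith : -1 < -β) (b - 1 + β) hz).const_mul β).congr_deriv ?_
  rw [show -β + 1 = 1 - β by ring]; ring

theorem tricomiW_ode {β b z : ℝ} (h1 : β < 1) (hz : 0 < z) :
    z * (-β * tricomiInt (1 - β) (b - 1 + β) z) + (b - z) * tricomiD β b z
      + β * tricomiW β b z = 0 := by
  have r1 := mul_tricomiInt (p := 1 - β) (by linarith) (b - 1 + β) hz
  have r2 := tricomiInt_add_one (p := -β) (by linarith) (b - 1 + β - 1) hz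
  rw [show 1 - β - 1 = -β by ring] at r1
  rw [show b - 1 + β - 1 + 1 = b - 1 + β by ring, show -β + 1 = 1 - β by ring] at r2
  simp only [tricomiD, tricomiW]
  linear_combination (-β) * r1 + β * (b - 1 + β) * r2

theorem continuousOn_tricomiInt {p q : ℝ} (hp : -1 < p) : ContinuousOn (tricomiInt p q) (Ioi 0) :=
  fun _ hz => (hasDerivAt_tricomiInt hp q hz).continuousAt.continuousWithinAt

theorem contDiffOn_tricomiInt (m : ℕ) (q : ℝ) :
    ∀ {p : ℝ}, -1 < p → ContDiffOn ℝ m (tricomiInt p q) (Ioi 0) := by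
  induction m with
  | zero => exact fun hp => contDiffOn_zero.2 (continuousOn_tricomiInt hp)
  | succ m ih =>
    intro p hp
    push_cast
    rw [contDiffOn_succ_iff_deriv_of_isOpen isOpen_Ioi]
    refine ⟨fun z hz => (hasDerivAt_tricomiInt hp q hz).differentiableAt.differentiableWithinAt,
      by simp, ?_⟩
    exact (ih (p := p + 1) (by linarith)).neg.congr fun z hz => (hasDerivAt_tricomiInt hp q hz).deriv

theorem contDiffOn_tricomiD (m : ℕ) {β : ℝ} (b : ℝ) (h1 : β < 1) :
    ContDiffOn ℝ m (tricomiD β b) (Ioi 0) :=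
  contDiffOn_const.mul (contDiffOn_tricomiInt m _ (by linarith))

theorem contDiffOn_tricomiW (m : ℕ) {β : ℝ} (b : ℝ) (h1 : β < 1) :
    ContDiffOn ℝ m (tricomiW β b) (Ioi 0) :=
  (contDiffOn_id.mul (contDiffOn_tricomiInt m _ (by linarith))).sub
    (contDiffOn_const.mul (contDiffOn_tricomiInt m _ (by linarith)))

theorem strictMonoOn_tricomiW {β b : ℝ} (h0 : 0 < β) (h1 : β < 1) :
    StrictMonoOn (tricomiW β b) (Ioi 0) := by
  refine strictMonoOn_of_hasDerivWithinAt_pos (convex_Ioi 0)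
    (fun z hz => (hasDerivAt_tricomiW h1 hz).continuousAt.continuousWithinAt)
    (fun z hz => (hasDerivAt_tricomiW h1 (interior_subset hz)).hasDerivWithinAt)
    (fun z hz => tricomiD_pos h0 h1 (interior_subset hz))

/-- With q = b - 1 + β, splitting the first integral gives W = (z - q) I(-β,q-1) + z I(1-β,q-1),
where I is `tricomiInt`. -/
theorem tricomiW_pos_of_le {β b z : ℝ} (h1 : β < 1) (hz : 0 < z)
    (h : b - 1 + β ≤ z) : 0 < tricomiW β b z := by
  have hp : -1 < -β := by linarith
  have r2 := tricomiInt_add_one hp (b - 1 + β - 1) hz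
  rw [show b - 1 + β - 1 + 1 = b - 1 + β by ring] at r2
  have p1 := tricomiInt_pos hp (b - 1 + β - 1) hz
  have p2 := tricomiInt_pos (p := -β + 1) (by linarith) (b - 1 + β - 1) hz
  rw [tricomiW, r2]
  nlinarith [mul_pos hz p2]

/-- Replacing 1 + t by t leaves the Gamma integral Γ(b) z^{-b}, which is at least Γ(b)/z. Hence W
falls at least logarithmically as z → 0, which forces a zero. -/
theorem div_le_tricomiD {β b z : ℝ} (hb : 1 ≤ b) (h0 : 0 < β) (h1 : β < 1) (hz : 0 < z)
    (hz1 : z ≤ 1) : β * Real.Gamma b * z⁻¹ ≤ tricomiD β b z := by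
  have hg := Real.Gamma_pos_of_pos (show 0 < b by linarith)
  have e : ∫ t in Ioi (0 : ℝ), t ^ (b - 1) * Real.exp (-(z * t)) = (1 / z) ^ b * Real.Gamma b :=
    Real.integral_rpow_mul_exp_neg_mul_Ioi (by linarith) hz
  have i : IntegrableOn (fun t : ℝ => t ^ (b - 1) * Real.exp (-(z * t))) (Ioi 0) := by
    have := integrableOn_rpow_mul_exp_neg_mul_rpow (s := b - 1) (p := 1) (by linarith) one_pos hz
    simpa using this
  have h2 : (1 / z) ^ b * Real.Gamma b ≤ tricomiInt (-β) (b - 1 + β) z := by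
    rw [← e, tricomiInt]
    refine setIntegral_mono_on i (integrableOn_tricomiIntegrand (by linarith) _ hz)
      measurableSet_Ioi fun t ht => ?_
    rw [mem_Ioi] at ht
    have h3 : t ^ (b - 1 + β) ≤ (1 + t) ^ (b - 1 + β) :=
      Real.rpow_le_rpow ht.le (by linarith) (by linarith)
    have h4 : t ^ (b - 1) = t ^ (-β) * t ^ (b - 1 + β) := by
      rw [← Real.rpow_add ht]; congr 1; ring
    rw [tricomiIntegrand, h4]
    calc _ = Real.exp (-(z * t)) * t ^ (-β) * t ^ (b - 1 + β) := by ring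
      _ ≤ _ := by gcongr
  have h5 : z⁻¹ ≤ (1 / z) ^ b := by
    have h6 : 1 ≤ 1 / z := by rw [le_div_iff₀ hz]; linarith
    calc z⁻¹ = (1 / z) ^ (1 : ℝ) := by rw [Real.rpow_one, one_div]
      _ ≤ _ := Real.rpow_le_rpow_of_exponent_le h6 hb
  rw [tricomiD, mul_assoc]
  refine mul_le_mul_of_nonneg_left (le_trans ?_ h2) h0.le
  rw [mul_comm]
  gcongr

theorem exists_tricomiW_zero {β b : ℝ} (hb : 1 ≤ b) (h0 : 0 < β) (h1 : β < 1) :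
    ∃ z, 0 < z ∧ tricomiW β b z = 0 := by
  have hg := Real.Gamma_pos_of_pos (show 0 < b by linarith)
  have hc : ContinuousOn (tricomiW β b) (Ioi 0) := (contDiffOn_tricomiW 0 b h1).continuousOn
  set C := β * Real.Gamma b with hC
  have hC0 : 0 < C := mul_pos h0 hg
  have hmono : MonotoneOn (fun z => tricomiW β b z - C * Real.log z) (Ioc 0 1) := by
    refine monotoneOn_of_hasDerivWithinAt_nonneg (convex_Ioc 0 1)
      (f' := fun z => tricomiD β b z - C * z⁻¹) ?_ ?_ ?_
    · refine (hc.mono Ioc_subset_Ioi_self).sub (continuousOn_const.mul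
        (Real.continuousOn_log.mono fun z hz => ne_of_gt hz.1))
    · intro z hz
      have hz' := interior_subset hz
      exact ((hasDerivAt_tricomiW h1 hz'.1).sub
        ((Real.hasDerivAt_log hz'.1.ne').const_mul C)).hasDerivWithinAt
    · intro z hz
      have hz' := interior_subset hz
      exact sub_nonneg.2 (div_le_tricomiD hb h0 h1 hz'.1 hz'.2)
  -- Chosen so that C log y = -|W(1)|, whence W(y) ≤ W(1) - |W(1)| ≤ 0.
  set y := Real.exp (-(|tricomiW β b 1| / C)) with hy
  have hy0 : 0 < y := Real.exp_pos _
  have hy1 : y ≤ 1 := Real.exp_le_one_iff.2 (neg_nonpos.2 (by positivity))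
  have h2 := hmono ⟨hy0, hy1⟩ ⟨one_pos, le_rfl⟩ hy1
  simp only [Real.log_one, mul_zero, sub_zero] at h2
  rw [hy, Real.log_exp, ← hy] at h2
  have h3 : C * -(|tricomiW β b 1| / C) = -|tricomiW β b 1| := by field_simp
  rw [h3] at h2
  have h4 : tricomiW β b y ≤ 0 := by have := le_abs_self (tricomiW β b 1); linarith
  set Z := max 1 (b - 1 + β) with hZ
  have hyZ : y ≤ Z := hy1.trans (le_max_left _ _)
  have h5 := tricomiW_pos_of_le h1 (hy0.trans_le hyZ) (le_max_right 1 (b - 1 + β))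
  obtain ⟨z, hz, hz'⟩ := intermediate_value_Icc hyZ
    (hc.mono fun z hz => hy0.trans_le hz.1) ⟨h4, h5.le⟩
  exact ⟨z, hy0.trans_le hz.1, hz'⟩

theorem tricomiW_zero_left (b : ℝ) {z : ℝ} (hz : 0 < z) : tricomiW 0 b z = 1 := by
  have := mul_tricomiInt_zero (b - 1) hz
  simp only [tricomiW, add_zero, neg_zero]
  linarith

theorem continuousOn_tricomiW_param (b : ℝ) {z : ℝ} (hz : 0 < z) :
    ContinuousOn (fun β => tricomiW β b z) (Icc 0 (1 / 2)) := by
  have h1 := continuousOn_tricomiInt_param (b - 1) hz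
  have h2 := continuousOn_tricomiInt_param (b - 1 - 1) hz
  refine (((continuousOn_const (c := z)).mul h1).sub ((by fun_prop : Continuous fun β : ℝ =>
    b - 1 + β).continuousOn.mul h2)).congr fun β _ => ?_
  simp only [tricomiW]
  rw [show b - 1 + β - 1 = b - 1 - 1 + β by ring]
  rfl

theorem tricomiW_le {β b z : ℝ} (hb : 1 ≤ b) (h0 : 0 ≤ β) (h1 : β < 1) (hz : 1 ≤ z) :
    tricomiW β b z ≤ z ^ β * tricomiInt (-β) (b - 1 + β) 1 := by
  have hz0 : 0 < z := by linarith
  have h2 := tricomiInt_le (p := -β) (q := b - 1 + β) (by linarith) (by linarith) hz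
  have h3 := tricomiInt_pos (p := -β) (by linarith) (b - 1 + β - 1) hz0
  calc tricomiW β b z ≤ z * tricomiInt (-β) (b - 1 + β) z := by
        rw [tricomiW]; nlinarith [mul_nonneg (show 0 ≤ b - 1 + β by linarith) h3.le]
    _ ≤ z * (z ^ (- -β - 1) * tricomiInt (-β) (b - 1 + β) 1) := by gcongr
    _ = _ := by
        rw [neg_neg, Real.rpow_sub_one hz0.ne']; field_simp

/-! ## The choice of the exponent -/

/-- The sign of G at a fixed point on either side of the zero persists for nearby β, and
monotonicity then traps the zero. Only continuity in β at each fixed z is needed. -/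
theorem continuousOn_zero_of_strictAntiOn {s : Set ℝ} {G : ℝ → ℝ → ℝ} {ζ : ℝ → ℝ}
    (hanti : ∀ β ∈ s, StrictAntiOn (G β) (Ioi 0)) (hpos : ∀ β ∈ s, 0 < ζ β)
    (hζ : ∀ β ∈ s, G β (ζ β) = 0) (hc : ∀ z, 0 < z → ContinuousOn (fun β => G β z) s) :
    ContinuousOn ζ s := by
  intro β₀ h₀
  refine tendsto_order.2 ⟨fun a ha => ?_, fun a ha => ?_⟩
  -- The lower barrier must be positive, where G is controlled.
  · set a' := max a (ζ β₀ / 2)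
    have hp := hpos β₀ h₀
    have ha0 : 0 < a' := lt_max_of_lt_right (half_pos hp)
    have ha1 : a' < ζ β₀ := max_lt ha (half_lt_self hp)
    have h1 : 0 < G β₀ a' := by rw [← hζ β₀ h₀]; exact hanti β₀ h₀ ha0 hp ha1
    filter_upwards [(hc a' ha0 β₀ h₀).eventually (lt_mem_nhds h1), self_mem_nhdsWithin] with β h2 hβ
    refine (le_max_left _ _).trans_lt ((hanti β hβ).lt_iff_gt (hpos β hβ) ha0 |>.1 ?_)
    rwa [hζ β hβ]
  · have hp := hpos β₀ h₀
    have ha0 : 0 < a := hp.trans ha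
    have h1 : G β₀ a < 0 := by rw [← hζ β₀ h₀]; exact hanti β₀ h₀ hp ha0 ha
    filter_upwards [(hc a ha0 β₀ h₀).eventually (gt_mem_nhds h1), self_mem_nhdsWithin] with β h2 hβ
    refine (hanti β hβ).lt_iff_gt ha0 (hpos β hβ) |>.1 ?_
    rwa [hζ β hβ]

/-- As ρ need not be injective, a solution of ρ(β) = ε is taken within ε of the infimum of all
solutions. For each δ the intermediate value theorem gives a solution below δ once ε < ρ(δ), so the
infimum tends to 0. -/
theorem exists_selection_tendsto_zero {ρ : ℝ → ℝ} {B : ℝ} (hB : 0 < B)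
    (hc : ContinuousOn ρ (Ioc 0 B)) (hpos : ∀ β ∈ Ioc 0 B, 0 < ρ β)
    (hlim : Tendsto ρ (𝓝[>] 0) (𝓝 0)) :
    ∃ β : ℝ → ℝ, (∀ ε, 0 < ε → ε < ρ B → β ε ∈ Ioc 0 B ∧ ρ (β ε) = ε) ∧
      Tendsto β (𝓝[>] 0) (𝓝 0) := by
  set S : ℝ → Set ℝ := fun ε => {β ∈ Ioc 0 B | ρ β = ε} with hS
  have hmem : ∀ δ ∈ Ioc 0 B, ∀ ε, 0 < ε → ε < ρ δ → ∃ β ∈ S ε, β ≤ δ := by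
    intro δ hδ ε h0 h1
    obtain ⟨γ, hγ, hγ'⟩ := ((hlim.eventually (gt_mem_nhds h0)).and
      (Ioo_mem_nhdsGT hδ.1)).exists
    obtain ⟨β, hβ, hβ'⟩ := intermediate_value_Icc hγ'.2.le
      (hc.mono fun x hx => ⟨hγ'.1.trans_le hx.1, hx.2.trans hδ.2⟩) ⟨hγ.le, h1.le⟩
    exact ⟨β, ⟨⟨hγ'.1.trans_le hβ.1, hβ.2.trans hδ.2⟩, hβ'⟩, hβ.2⟩
  have hbdd : ∀ ε, BddBelow (S ε) := fun ε => ⟨0, fun β hβ => hβ.1.1.le⟩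
  have hch : ∀ ε, ∃ β, 0 < ε → ε < ρ B → β ∈ S ε ∧ β < sInf (S ε) + ε := by
    intro ε
    by_cases h : 0 < ε ∧ ε < ρ B
    · obtain ⟨β, hβ, -⟩ := hmem B ⟨hB, le_rfl⟩ ε h.1 h.2
      obtain ⟨β', h1, h2⟩ := exists_lt_of_csInf_lt ⟨β, hβ⟩ (lt_add_of_pos_right (sInf (S ε)) h.1)
      exact ⟨β', fun _ _ => ⟨h1, h2⟩⟩
    · exact ⟨0, fun h1 h2 => absurd ⟨h1, h2⟩ h⟩
  choose β hβ using hch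
  refine ⟨β, fun ε h0 h1 => (hβ ε h0 h1).1, ?_⟩
  refine tendsto_order.2 ⟨fun a ha => ?_, fun η hη => ?_⟩
  · filter_upwards [Ioo_mem_nhdsGT (hpos B ⟨hB, le_rfl⟩)] with ε hε
    exact ha.trans (hβ ε hε.1 hε.2).1.1.1
  · set δ := min B (η / 2)
    have hδ : δ ∈ Ioc 0 B := ⟨lt_min hB (half_pos hη), min_le_left _ _⟩
    filter_upwards [Ioo_mem_nhdsGT (hpos B ⟨hB, le_rfl⟩), Ioo_mem_nhdsGT (hpos δ hδ),
      Ioo_mem_nhdsGT (half_pos hη)] with ε h1 h2 h3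
    obtain ⟨γ, hγ, hγ'⟩ := hmem δ hδ ε h2.1 h2.2
    have h4 := csInf_le (hbdd ε) hγ
    have h5 := (hβ ε h1.1 h1.2).2
    have h6 : δ ≤ η / 2 := min_le_right _ _
    linarith [h3.2]

theorem kummerM_zero_left (b z : ℝ) : kummerM 0 b z = 1 := by
  rw [kummerM_eq_tsum, tsum_eq_single 0]
  · simp [kummerCoeff_zero]
  · intro k hk; simp [kummerCoeff, ascPochhammer_ne_zero_eval_zero ℝ hk]

/-- Apply the selection to ρ = t/k, the ratio of the two zeros. The cap β ≤ 1/4 keeps β inside the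
range of parameter continuity and gives the later bounds α < 1 and β < 1/2. -/
theorem exists_matching_exponent {b : ℝ} (hb : 1 ≤ b) :
    ∃ ε₀ : ℝ, 0 < ε₀ ∧ ε₀ < 1 ∧ ∃ β : ℝ → ℝ,
      (∀ ε, 0 < ε → ε < ε₀ → 0 < β ε ∧ β ε ≤ 1 / 4 ∧
        ∃ z, 0 < z ∧ kummerM (-β ε) b z = 0 ∧ tricomiW (β ε) b (ε * z) = 0) ∧
      Tendsto β (𝓝[>] 0) (𝓝 0) := by
  have hK : ∀ β : ℝ, ∃ z, β ∈ Ioc (0 : ℝ) (1 / 4) → 0 < z ∧ kummerM (-β) b z = 0 := fun β => by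
    by_cases h : β ∈ Ioc (0 : ℝ) (1 / 4)
    · obtain ⟨z, hz⟩ := exists_kummerM_zero hb h.1 (by linarith [h.2]); exact ⟨z, fun _ => hz⟩
    · exact ⟨0, fun h' => absurd h' h⟩
  have hT : ∀ β : ℝ, ∃ z, β ∈ Ioc (0 : ℝ) (1 / 4) → 0 < z ∧ tricomiW β b z = 0 := fun β => by
    by_cases h : β ∈ Ioc (0 : ℝ) (1 / 4)
    · obtain ⟨z, hz⟩ := exists_tricomiW_zero hb h.1 (by linarith [h.2]); exact ⟨z, fun _ => hz⟩
    · exact ⟨0, fun h' => absurd h' h⟩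
  choose k hk using hK
  choose t ht using hT
  have hI : Ioc (0 : ℝ) (1 / 4) ∈ 𝓝[>] (0 : ℝ) := Ioc_mem_nhdsGT (by norm_num)
  have cK : ∀ z, ContinuousOn (fun β => kummerM (-β) b z) (Icc 0 (1 / 2)) := fun z =>
    (continuousOn_kummerM_param (by linarith) z).comp continuousOn_neg fun β hβ => by
      rw [mem_ofPred_eq, abs_neg, abs_of_nonneg hβ.1]; linarith [hβ.2]
  have cT : ∀ z, 0 < z → ContinuousOn (fun β => tricomiW β b z) (Icc 0 (1 / 2)) :=
    fun z hz => continuousOn_tricomiW_param b hz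
  have hsub : Ioc (0 : ℝ) (1 / 4) ⊆ Icc 0 (1 / 2) := fun β hβ => ⟨hβ.1.le, by linarith [hβ.2]⟩
  have aK : ∀ β ∈ Ioc (0 : ℝ) (1 / 4), StrictAntiOn (kummerM (-β) b) (Ioi 0) := fun β hβ =>
    (strictAntiOn_kummerM hb hβ.1 (by linarith [hβ.2])).mono Ioi_subset_Ici_self
  have aT : ∀ β ∈ Ioc (0 : ℝ) (1 / 4), StrictMonoOn (tricomiW β b) (Ioi 0) := fun β hβ =>
    strictMonoOn_tricomiW hβ.1 (by linarith [hβ.2])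
  have ck : ContinuousOn k (Ioc 0 (1 / 4)) :=
    continuousOn_zero_of_strictAntiOn aK (fun β hβ => (hk β hβ).1) (fun β hβ => (hk β hβ).2)
      fun z _ => (cK z).mono hsub
  have ct : ContinuousOn t (Ioc 0 (1 / 4)) :=
    continuousOn_zero_of_strictAntiOn (G := fun β z => -tricomiW β b z) (fun β hβ => (aT β hβ).neg)
      (fun β hβ => (ht β hβ).1) (fun β hβ => by rw [(ht β hβ).2, neg_zero])
      fun z hz => ((cT z hz).mono hsub).neg
  have h0 : (0 : ℝ) ∈ Icc (0 : ℝ) (1 / 2) := by constructor <;> norm_num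
  have hle : 𝓝[>] (0 : ℝ) ≤ 𝓝[Icc 0 (1 / 2)] 0 := by
    refine le_inf inf_le_left (le_principal_iff.2 ?_)
    exact mem_of_superset hI hsub
  have hlim : Tendsto (fun β => t β / k β) (𝓝[>] 0) (𝓝 0) := by
    refine tendsto_order.2 ⟨fun a ha => ?_, fun η hη => ?_⟩
    · filter_upwards [hI] with β hβ
      exact ha.trans (div_pos (ht β hβ).1 (hk β hβ).1)
    -- Both functions are identically 1 at β = 0, so for small β they are still positive at 1 and at
    -- η respectively; by monotonicity k > 1 and t < η.
    · have e1 : ∀ᶠ β in 𝓝[>] (0 : ℝ), 0 < kummerM (-β) b 1 :=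
        hle (((cK 1) 0 h0).eventually (lt_mem_nhds (by simp [kummerM_zero_left])))
      have e2 : ∀ᶠ β in 𝓝[>] (0 : ℝ), 0 < tricomiW β b η :=
        hle (((cT η hη) 0 h0).eventually (lt_mem_nhds (by simp [tricomiW_zero_left b hη])))
      filter_upwards [hI, e1, e2] with β hβ h1 h2
      have hk' := hk β hβ
      have ht' := ht β hβ
      have h3 : 1 < k β := by
        refine ((aK β hβ).lt_iff_gt hk'.1 (mem_Ioi.2 one_pos)).1 ?_
        rwa [hk'.2]
      have h4 : t β < η := by
        refine ((aT β hβ).lt_iff_lt ht'.1 hη).1 ?_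
        rwa [ht'.2]
      rw [div_lt_iff₀ hk'.1]
      nlinarith
  obtain ⟨β, hβ, hβ'⟩ := exists_selection_tendsto_zero (B := 1 / 4) (by norm_num)
    (ct.div ck fun β hβ => (hk β hβ).1.ne') (fun β hβ => div_pos (ht β hβ).1 (hk β hβ).1) hlim
  have hB : (1 / 4 : ℝ) ∈ Ioc (0 : ℝ) (1 / 4) := by constructor <;> norm_num
  refine ⟨min (1 / 2) (t (1 / 4) / k (1 / 4)),
    lt_min (by norm_num) (div_pos (ht _ hB).1 (hk _ hB).1),
    (min_le_left _ _).trans_lt (by norm_num), β, fun ε h1 h2 => ?_, hβ'⟩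
  obtain ⟨h3, h4⟩ := hβ ε h1 (h2.trans_le (min_le_right _ _))
  have hk' := hk _ h3
  refine ⟨h3.1, h3.2, k (β ε), hk'.1, hk'.2, ?_⟩
  have h5 : ε * k (β ε) = t (β ε) := by
    nth_rewrite 1 [← h4]; exact div_mul_cancel₀ _ hk'.1.ne'
  rw [h5]; exact (ht _ h3).2

/-! ## Functions that are Lipschitz near a point -/

/-- `f` is Lipschitz on a neighbourhood of `p`. -/
def LipschitzNear {X Y : Type*} [PseudoEMetricSpace X] [PseudoEMetricSpace Y] (f : X → Y) (p : X) :
    Prop :=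
  ∃ K, ∃ t ∈ 𝓝 p, LipschitzOnWith K f t

section LipschitzNear

variable {X Y Z : Type*} [PseudoEMetricSpace X] [PseudoEMetricSpace Y] [PseudoEMetricSpace Z]

theorem LipschitzNear.continuousAt {f : X → Y} {p : X} (hf : LipschitzNear f p) :
    ContinuousAt f p := by
  obtain ⟨K, t, ht, h⟩ := hf
  exact h.continuousOn.continuousAt ht

theorem LipschitzNear.comp {g : Y → Z} {f : X → Y} {p : X} (hg : LipschitzNear g (f p))
    (hf : LipschitzNear f p) : LipschitzNear (fun x => g (f x)) p := by
  have hc := hf.continuousAt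
  obtain ⟨K, t, ht, h⟩ := hf
  obtain ⟨L, s, hs, h'⟩ := hg
  exact ⟨L * K, t ∩ f ⁻¹' s, inter_mem ht (hc hs),
    h'.comp (h.mono inter_subset_left) fun x hx => hx.2⟩

theorem LipschitzNear.prodMk {g : X → Z} {f : X → Y} {p : X} (hf : LipschitzNear f p)
    (hg : LipschitzNear g p) : LipschitzNear (fun x => (f x, g x)) p := by
  obtain ⟨K, t, ht, h⟩ := hf
  obtain ⟨L, s, hs, h'⟩ := hg
  exact ⟨max K L, t ∩ s, inter_mem ht hs, (h.mono inter_subset_left).prodMk (h'.mono inter_subset_right)⟩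

theorem LipschitzNear.congr {f g : X → Y} {p : X} (hf : LipschitzNear f p) (h : f =ᶠ[𝓝 p] g) :
    LipschitzNear g p := by
  obtain ⟨K, t, ht, h'⟩ := hf
  refine ⟨K, t ∩ {x | f x = g x}, inter_mem ht h, fun x hx y hy => ?_⟩
  have e1 : f x = g x := hx.2
  have e2 : f y = g y := hy.2
  rw [← e1, ← e2]
  exact h' hx.1 hy.1

theorem LipschitzWith.lipschitzNear {f : X → Y} {K} (hf : LipschitzWith K f) (p : X) :
    LipschitzNear f p := ⟨K, univ, univ_mem, hf.lipschitzOnWith⟩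

theorem ContDiffAt.lipschitzNear {E F : Type*} [NormedAddCommGroup E] [NormedSpace ℝ E]
    [NormedAddCommGroup F] [NormedSpace ℝ F] {f : E → F} {p : E} (hf : ContDiffAt ℝ 1 f p) :
    LipschitzNear f p :=
  hf.exists_lipschitzOnWith

theorem LipschitzNear.mul {f g : X → ℝ} {p : X} (hf : LipschitzNear f p) (hg : LipschitzNear g p) :
    LipschitzNear (fun x => f x * g x) p :=
  LipschitzNear.comp (g := fun q : ℝ × ℝ => q.1 * q.2)
    (ContDiffAt.lipschitzNear (contDiff_fst.mul contDiff_snd).contDiffAt) (hf.prodMk hg)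

theorem LipschitzNear.add {f g : X → ℝ} {p : X} (hf : LipschitzNear f p) (hg : LipschitzNear g p) :
    LipschitzNear (fun x => f x + g x) p :=
  LipschitzNear.comp (g := fun q : ℝ × ℝ => q.1 + q.2)
    (ContDiffAt.lipschitzNear (contDiff_fst.add contDiff_snd).contDiffAt) (hf.prodMk hg)

end LipschitzNear

/-! ## The two-phase profile in the variable `w = s² / 4` -/

/-- `F`, with derivatives `D` and `D₂`, solves Kummer's equation
`w F'' + (b - λ w) F' + λ β F = 0` with `λ = 1` for `w < w₀`, where `F > 0`, and with `λ = ε` for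
`w > w₀`, where `F < 0`. -/
structure IsTwoPhaseProfile (b β ε w₀ : ℝ) (F D D₂ : ℝ → ℝ) : Prop where
  pos : 0 < w₀
  hasDerivAt : ∀ w, HasDerivAt F (D w) w
  lipschitzNear : ∀ w, LipschitzNear D w
  contDiffAt : ∀ w, w ≠ w₀ → ContDiffAt ℝ 2 F w
  hasDerivAt_deriv : ∀ w, w ≠ w₀ → HasDerivAt D (D₂ w) w
  value_pos : ∀ w, 0 ≤ w → w < w₀ → 0 < F w
  value_eq : F w₀ = 0
  value_neg : ∀ w, w₀ < w → F w < 0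
  ode_pos : ∀ w, 0 ≤ w → w < w₀ → w * D₂ w + (b - w) * D w + β * F w = 0
  ode_neg : ∀ w, w₀ < w → w * D₂ w + (b - ε * w) * D w + ε * β * F w = 0
  value_zero : F 0 = 1
  bounded : ∃ C, ∀ᶠ w in atTop, |F w| ≤ C * w ^ β

/-- `g` up to `w₀` and `h` beyond. -/
noncomputable def glue (w₀ : ℝ) (g h : ℝ → ℝ) (w : ℝ) : ℝ := if w ≤ w₀ then g w else h w

section glue

variable {w₀ w : ℝ} {g h g' h' : ℝ → ℝ}

theorem glue_of_le (hw : w ≤ w₀) : glue w₀ g h w = g w := if_pos hw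

theorem glue_of_lt (hw : w₀ < w) : glue w₀ g h w = h w := if_neg hw.not_ge

theorem glue_eventuallyEq_left (hw : w < w₀) : glue w₀ g h =ᶠ[𝓝 w] g := by
  filter_upwards [Iio_mem_nhds hw] with x hx using glue_of_le hx.le

theorem glue_eventuallyEq_right (hw : w₀ < w) : glue w₀ g h =ᶠ[𝓝 w] h := by
  filter_upwards [Ioi_mem_nhds hw] with x hx using glue_of_lt hx

theorem hasDerivAt_glue (hg : ∀ w ≤ w₀, HasDerivAt g (g' w) w)
    (hh : ∀ w, w₀ ≤ w → HasDerivAt h (h' w) w) (e : g w₀ = h w₀) (e' : g' w₀ = h' w₀) (w : ℝ) :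
    HasDerivAt (glue w₀ g h) (glue w₀ g' h' w) w := by
  rcases lt_trichotomy w w₀ with hw | rfl | hw
  · rw [glue_of_le hw.le]
    exact (hg w hw.le).congr_of_eventuallyEq (glue_eventuallyEq_left hw)
  · rw [glue_of_le le_rfl, ← hasDerivWithinAt_univ, ← Iic_union_Ici (a := w)]
    refine HasDerivWithinAt.union ?_ ?_
    · exact (hg w le_rfl).hasDerivWithinAt.congr (fun x hx => glue_of_le hx) (glue_of_le le_rfl)
    · rw [e']
      refine (hh w le_rfl).hasDerivWithinAt.congr (fun x hx => ?_) ((glue_of_le le_rfl).trans e)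
      rcases eq_or_lt_of_le (mem_Ici.1 hx) with rfl | hx
      · exact (glue_of_le le_rfl).trans e
      · exact glue_of_lt hx
  · rw [glue_of_lt hw]
    exact (hh w hw.le).congr_of_eventuallyEq (glue_eventuallyEq_right hw)

/-- The glued function is g(min(w,w₀)) + h(max(w,w₀)) - g(w₀). -/
theorem lipschitzNear_glue (hg : ∀ w ≤ w₀, LipschitzNear g w)
    (hh : ∀ w, w₀ ≤ w → LipschitzNear h w) (e : g w₀ = h w₀) (w : ℝ) :
    LipschitzNear (glue w₀ g h) w := by
  have h1 : LipschitzNear (fun w => g (min w w₀)) w :=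
    LipschitzNear.comp (hg _ (min_le_right _ _)) ((LipschitzWith.id.min_const w₀).lipschitzNear w)
  have h2 : LipschitzNear (fun w => h (max w w₀)) w :=
    LipschitzNear.comp (hh _ (le_max_right _ _)) ((LipschitzWith.id.max_const w₀).lipschitzNear w)
  have h3 : LipschitzNear (fun _ : ℝ => -g w₀) w := (LipschitzWith.const _).lipschitzNear w
  refine ((h1.add h2).add h3).congr (Eventually.of_forall fun x => ?_)
  rcases le_or_gt x w₀ with hx | hx
  · simp only [min_eq_left hx, max_eq_right hx, glue_of_le hx, e]; ring
  · simp only [min_eq_right hx.le, max_eq_left hx.le, glue_of_lt hx]; ring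

end glue

/-- The derivative of `kummerD β b`. -/
noncomputable def kummerD₂ (β b z : ℝ) : ℝ :=
  -β / b * ((1 - β) / (b + 1) * kummerM (2 - β) (b + 2) z)

theorem hasDerivAt_kummerD {β b : ℝ} (hb : 1 ≤ b) (h0 : 0 ≤ β) (h1 : β ≤ 1) (z : ℝ) :
    HasDerivAt (kummerD β b) (kummerD₂ β b z) z := by
  have := (hasDerivAt_kummerM (a := 1 - β) (b := b + 1) (by linarith)
    (by rw [abs_of_nonneg (by linarith)]; linarith) z).const_mul (-β / b)
  rw [show 1 - β + 1 = 2 - β by ring, show b + 1 + 1 = b + 2 by ring] at this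
  exact this

theorem kummerM_neg_ode {β b : ℝ} (hb : 1 ≤ b) (h0 : 0 ≤ β) (h1 : β ≤ 1) (z : ℝ) :
    z * kummerD₂ β b z + (b - z) * kummerD β b z + β * kummerM (-β) b z = 0 := by
  have := kummerM_ode (a := -β) (b := b) (by linarith)
    (by rw [abs_neg, abs_of_nonneg h0]; linarith) z
  rw [show -β + 1 = 1 - β by ring, show -β + 2 = 2 - β by ring] at this
  rw [kummerD₂, kummerD]; linarith

theorem isTwoPhaseProfile_glue {b β ε w₀ : ℝ} (hb : 1 ≤ b) (h0 : 0 < β) (h1 : β < 1) (hε : 0 < ε)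
    (hw : 0 < w₀) (hM : kummerM (-β) b w₀ = 0) (hW : tricomiW β b (ε * w₀) = 0) :
    ∃ K, 0 < K ∧ IsTwoPhaseProfile b β ε w₀
      (glue w₀ (kummerM (-β) b) fun w => -K * tricomiW β b (ε * w))
      (glue w₀ (kummerD β b) fun w => -K * (tricomiD β b (ε * w) * ε))
      (glue w₀ (kummerD₂ β b)
        fun w => -K * (-β * tricomiInt (1 - β) (b - 1 + β) (ε * w) * ε * ε)) := by
  have hD := tricomiD_pos (b := b) h0 h1 (mul_pos hε hw)
  have hMd : kummerD β b w₀ < 0 := (kummerD_le hb h0 h1 hw.le).trans_lt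
    (div_neg_of_neg_of_pos (by linarith) (by linarith))
  -- The constant equating the two slopes at w₀; it is positive because M decreases and W increases
  -- there.
  set K := -kummerD β b w₀ / (tricomiD β b (ε * w₀) * ε) with hK
  have hK0 : 0 < K := div_pos (by linarith) (mul_pos hD hε)
  have hKe : kummerD β b w₀ = -K * (tricomiD β b (ε * w₀) * ε) := by
    rw [hK]; field_simp
  have hl : ∀ w : ℝ, HasDerivAt (fun w => ε * w) ε w := fun w => by
    simpa using (hasDerivAt_id w).const_mul ε
  have hpos : ∀ {w}, w₀ ≤ w → 0 < ε * w := fun h => mul_pos hε (hw.trans_le h)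
  have dM := hasDerivAt_kummerM_neg hb h0.le h1.le
  have dW : ∀ w, w₀ ≤ w → HasDerivAt (fun w => -K * tricomiW β b (ε * w))
      (-K * (tricomiD β b (ε * w) * ε)) w := fun w h =>
    ((hasDerivAt_tricomiW h1 (hpos h)).comp w (hl w)).const_mul (-K)
  have dD : ∀ w, w₀ ≤ w → HasDerivAt (fun w => -K * (tricomiD β b (ε * w) * ε))
      (-K * (-β * tricomiInt (1 - β) (b - 1 + β) (ε * w) * ε * ε)) w := fun w h =>
    (((hasDerivAt_tricomiD h1 (hpos h)).comp w (hl w)).mul_const ε).const_mul (-K)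
  have hlin : ∀ (m : ℕ) (w : ℝ), ContDiffAt ℝ m (fun w => ε * w) w := fun m w => by fun_prop
  refine ⟨K, hK0, hw, ?_, ?_, ?_, ?_, ?_, ?_, ?_, ?_, ?_, ?_, ?_⟩
  · exact hasDerivAt_glue (fun w _ => dM w) dW (by rw [hM, hW, mul_zero]) hKe
  · refine lipschitzNear_glue (fun w _ => ContDiffAt.lipschitzNear ?_)
      (fun w h => ContDiffAt.lipschitzNear ?_) hKe
    · exact (contDiff_const.mul (contDiff_kummerM 1 (by linarith)
        (by rw [abs_of_nonneg (by linarith)]; linarith))).contDiffAt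
    · exact contDiffAt_const.mul ((((contDiffOn_tricomiD 1 b h1).contDiffAt
        (Ioi_mem_nhds (hpos h))).comp w (hlin 1 w)).mul contDiffAt_const)
  · intro w hne
    rcases lt_or_gt_of_ne hne with h | h
    · exact (contDiff_kummerM 2 (by linarith) (by rw [abs_neg, abs_of_nonneg h0.le]; linarith)
        ).contDiffAt.congr_of_eventuallyEq (glue_eventuallyEq_left h)
    · exact (contDiffAt_const.mul (((contDiffOn_tricomiW 2 b h1).contDiffAt
        (Ioi_mem_nhds (hpos h.le))).comp w (hlin 2 w))).congr_of_eventuallyEq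
        (glue_eventuallyEq_right h)
  · intro w hne
    rcases lt_or_gt_of_ne hne with h | h
    · rw [glue_of_le h.le]
      exact (hasDerivAt_kummerD hb h0.le h1.le w).congr_of_eventuallyEq (glue_eventuallyEq_left h)
    · rw [glue_of_lt h]
      exact (dD w h.le).congr_of_eventuallyEq (glue_eventuallyEq_right h)
  · intro w hw0 h
    rw [glue_of_le h.le, ← hM]
    exact strictAntiOn_kummerM hb h0 h1 hw0 hw.le h
  · rw [glue_of_le le_rfl, hM]
  · intro w h
    have := strictMonoOn_tricomiW (b := b) h0 h1 (hpos le_rfl) (hpos h.le)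
      (mul_lt_mul_of_pos_left h hε)
    rw [hW] at this
    rw [glue_of_lt h]
    nlinarith
  · intro w _ h
    rw [glue_of_le h.le, glue_of_le h.le, glue_of_le h.le]
    exact kummerM_neg_ode hb h0.le h1.le w
  · intro w h
    rw [glue_of_lt h, glue_of_lt h, glue_of_lt h]
    -- Kummer's equation at z = εw, multiplied by -Kε, is the equation with λ = ε.
    have := tricomiW_ode (b := b) h1 (hpos h.le)
    linear_combination (-K * ε) * this
  · rw [glue_of_le hw.le, kummerM_zero]
  · refine ⟨K * (ε ^ β * tricomiInt (-β) (b - 1 + β) 1), ?_⟩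
    filter_upwards [eventually_gt_atTop w₀, eventually_ge_atTop ε⁻¹] with w h h'
    have h2 : 1 ≤ ε * w := by
      rw [inv_le_iff_one_le_mul₀ hε] at h'; linarith
    have h3 := tricomiW_le hb h0.le h1 h2
    have h4 := strictMonoOn_tricomiW (b := b) h0 h1 (hpos le_rfl) (hpos h.le)
      (mul_lt_mul_of_pos_left h hε)
    rw [hW] at h4
    rw [glue_of_lt h, neg_mul, abs_neg, abs_of_pos (mul_pos hK0 h4)]
    calc _ ≤ K * ((ε * w) ^ β * tricomiInt (-β) (b - 1 + β) 1) := by gcongr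
      _ = _ := by rw [Real.mul_rpow hε.le (hw.trans h).le]; ring

theorem IsTwoPhaseProfile.continuous_deriv {b β ε w₀ : ℝ} {F D D₂ : ℝ → ℝ}
    (hF : IsTwoPhaseProfile b β ε w₀ F D D₂) : Continuous D :=
  continuous_iff_continuousAt.2 fun w => (hF.lipschitzNear w).continuousAt

theorem IsTwoPhaseProfile.contDiff {b β ε w₀ : ℝ} {F D D₂ : ℝ → ℝ}
    (hF : IsTwoPhaseProfile b β ε w₀ F D D₂) : ContDiff ℝ 1 F := by
  rw [contDiff_one_iff_deriv, show deriv F = D from funext fun w => (hF.hasDerivAt w).deriv]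
  exact ⟨fun w => (hF.hasDerivAt w).differentiableAt, hF.continuous_deriv⟩

/-- With w = s²/4, f' = (s/2)D and f'' = w D₂ + D/2. The term (n-1)f'/s adds (n-1)D/2, which
produces b = n/2, and the drift sf'/2 is wD. -/
theorem IsTwoPhaseProfile.isProfileSolution {n : ℕ} {α ε w₀ : ℝ} {F D D₂ f : ℝ → ℝ}
    (hF : IsTwoPhaseProfile ((n : ℝ) / 2) (α / 2) ε w₀ F D D₂)
    (hf : ∀ s, 0 ≤ s → f s = F (s ^ 2 / 4)) : IsProfileSolution n α ε f := by
  have hq : ∀ s : ℝ, HasDerivAt (fun s : ℝ => s ^ 2 / 4) (s / 2) s := fun s =>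
    ((hasDerivAt_pow 2 s).div_const 4).congr_deriv (by norm_num; ring)
  have hd1 : ∀ s : ℝ, HasDerivAt (fun s => F (s ^ 2 / 4)) (D (s ^ 2 / 4) * (s / 2)) s := fun s =>
    (hF.hasDerivAt _).comp s (hq s)
  have hev : ∀ s : ℝ, 0 < s → f =ᶠ[𝓝 s] fun s => F (s ^ 2 / 4) := fun s hs => by
    filter_upwards [Ioi_mem_nhds hs] with y hy using hf y (le_of_lt hy)
  have hd : ∀ s : ℝ, 0 < s → deriv f s = D (s ^ 2 / 4) * (s / 2) := fun s hs =>
    ((hd1 s).congr_of_eventuallyEq (hev s hs)).deriv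
  have hd2 : ∀ s : ℝ, 0 < s → s ^ 2 / 4 ≠ w₀ → HasDerivAt (deriv f)
      (D₂ (s ^ 2 / 4) * (s / 2) * (s / 2) + D (s ^ 2 / 4) * (1 / 2)) s := fun s hs hne => by
    have h1 := ((hF.hasDerivAt_deriv _ hne).comp s (hq s)).mul ((hasDerivAt_id s).div_const 2)
    refine h1.congr_of_eventuallyEq ?_
    filter_upwards [Ioi_mem_nhds hs] with y hy using hd y hy
  refine ⟨?_, ?_, ?_, ?_, ?_, ?_⟩
  · refine ContDiffOn.congr (f := fun s => F (s ^ 2 / 4)) ?_ fun s hs => hf s hs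
    exact (hF.contDiff.comp (by fun_prop : ContDiff ℝ 1 fun s : ℝ => s ^ 2 / 4)).contDiffOn
  · intro s hs hpos
    rw [hf s hs.le] at hpos
    have hlt : s ^ 2 / 4 < w₀ := by
      by_contra! h
      rcases h.eq_or_lt with h | h
      · rw [← h, hF.value_eq] at hpos; exact lt_irrefl _ hpos
      · exact (hF.value_neg _ h).not_gt hpos
    refine ⟨_, hd2 s hs hlt.ne, ?_⟩
    rw [hd s hs, hf s hs.le]
    have := hF.ode_pos _ (by positivity) hlt
    have e : ((n : ℝ) - 1) / s * (D (s ^ 2 / 4) * (s / 2)) = ((n : ℝ) - 1) / 2 * D (s ^ 2 / 4) := by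
      field_simp
    rw [sub_mul, e]
    linear_combination this
  · intro s hs hneg
    rw [hf s hs.le] at hneg
    have hlt : w₀ < s ^ 2 / 4 := by
      by_contra! h
      rcases h.eq_or_lt with h | h
      · rw [h, hF.value_eq] at hneg; exact lt_irrefl _ hneg
      · exact (hF.value_pos _ (by positivity) h).not_gt hneg
    refine ⟨_, hd2 s hs hlt.ne', ?_⟩
    rw [hd s hs, hf s hs.le]
    have := hF.ode_neg _ hlt
    have e : ((n : ℝ) - 1) / s * (D (s ^ 2 / 4) * (s / 2)) = ((n : ℝ) - 1) / 2 * D (s ^ 2 / 4) := by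
      field_simp
    rw [sub_mul, e]
    linear_combination this
  · rw [hf 0 le_rfl]; simpa using hF.value_zero
  · refine HasDerivWithinAt.congr (f := fun s => F (s ^ 2 / 4)) ?_ (fun s hs => hf s hs)
      (hf 0 le_rfl)
    simpa using (hd1 0).hasDerivWithinAt (s := Ici 0)
  · obtain ⟨C, hC⟩ := hF.bounded
    have ht : Tendsto (fun s : ℝ => s ^ 2 / 4) atTop atTop :=
      (tendsto_pow_atTop two_ne_zero).atTop_div_const (by norm_num)
    refine Asymptotics.IsBigO.of_bound (C * (1 / 4) ^ (α / 2)) ?_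
    filter_upwards [ht.eventually hC, eventually_gt_atTop 0] with s h hs
    rw [hf s hs.le, norm_mul, norm_one, mul_one, Real.norm_eq_abs, Real.norm_eq_abs,
      abs_of_pos (Real.rpow_pos_of_pos hs _)]
    have e : (s ^ 2 / 4) ^ (α / 2) = s ^ α * (1 / 4) ^ (α / 2) := by
      rw [div_eq_mul_one_div, Real.mul_rpow (by positivity) (by norm_num), ← Real.rpow_natCast,
        ← Real.rpow_mul hs.le]
      congr 2; push_cast; ring
    rw [e] at h
    calc s ^ (-α) * |F (s ^ 2 / 4)| ≤ s ^ (-α) * (C * (s ^ α * (1 / 4) ^ (α / 2))) := by gcongr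
      _ = (s ^ (-α) * s ^ α) * (C * (1 / 4) ^ (α / 2)) := by ring
      _ = _ := by rw [← Real.rpow_add hs, neg_add_cancel, Real.rpow_zero, one_mul]

/-! ## The self-similar function -/

section SelfSimilar

variable {n : ℕ}

/-- The similarity variable `|x|² / (4 (-t))`. -/
noncomputable def simVar (p : SpaceTime n) : ℝ := ‖p.1‖ ^ 2 / (4 * √(-p.2) ^ 2)

theorem simVar_eq {p : SpaceTime n} (hp : p.2 < 0) : simVar p = ‖p.1‖ ^ 2 / (4 * -p.2) := by
  rw [simVar, Real.sq_sqrt (by linarith)]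

theorem simVar_nonneg (p : SpaceTime n) : 0 ≤ simVar p := by unfold simVar; positivity

theorem norm_sq_eq_simVar {p : SpaceTime n} (hp : p.2 < 0) :
    ‖p.1‖ ^ 2 = simVar p * (4 * -p.2) := by
  have : p.2 ≠ 0 := hp.ne
  rw [simVar_eq hp]; field_simp

/-- The self-similar function with profile `F` in the variable `w`. -/
noncomputable def simSol (β : ℝ) (F : ℝ → ℝ) (p : SpaceTime n) : ℝ :=
  (-p.2) ^ β * F (simVar p)

/-- The space gradient of `simSol β F`, where `D = F'`. -/
noncomputable def simGrad (β : ℝ) (D : ℝ → ℝ) (p : SpaceTime n) : EuclideanSpace ℝ (Fin n) :=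
  ((-p.2) ^ β / (2 * -p.2) * D (simVar p)) • p.1

/-- Keeping √(-t)² in `simVar` makes the identity hold at every point, without a sign condition on
t. -/
theorem selfSimilar_eq_simSol {α : ℝ} {f F : ℝ → ℝ} (hf : ∀ s, 0 ≤ s → f s = F (s ^ 2 / 4)) :
    selfSimilar n α f = simSol (α / 2) F := by
  funext p
  rw [selfSimilar, simSol, hf _ (by positivity), simVar, div_pow]
  congr 2; rw [div_div, mul_comm]

theorem contDiffAt_simVar {p : SpaceTime n} (hp : p.2 < 0) (m : ℕ) :
    ContDiffAt ℝ m (simVar (n := n)) p := by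
  have h1 : ContDiffAt ℝ m (fun p : SpaceTime n => ‖p.1‖ ^ 2 / (4 * -p.2)) p := by
    refine ContDiffAt.div ?_ ?_ (by simp; linarith)
    · exact (contDiff_norm_sq ℝ (E := EuclideanSpace ℝ (Fin n))).contDiffAt.comp p contDiffAt_fst
    · exact contDiffAt_const.mul contDiffAt_snd.neg
  refine h1.congr_of_eventuallyEq ?_
  filter_upwards [(continuous_snd (X := EuclideanSpace ℝ (Fin n))).continuousAt.eventually
    (gt_mem_nhds hp)] with q hq using simVar_eq hq

theorem contDiffAt_neg_time_rpow {p : SpaceTime n} (hp : p.2 < 0) (β : ℝ) (m : ℕ) :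
    ContDiffAt ℝ m (fun p : SpaceTime n => (-p.2) ^ β) p :=
  ContDiffAt.rpow_const_of_ne contDiffAt_snd.neg (by linarith)

theorem contDiffAt_simSol {p : SpaceTime n} (hp : p.2 < 0) (β : ℝ) {m : ℕ} {F : ℝ → ℝ}
    (hF : ContDiffAt ℝ m F (simVar p)) : ContDiffAt ℝ m (simSol β F) p :=
  (contDiffAt_neg_time_rpow hp β m).mul (hF.comp p (contDiffAt_simVar hp m))

theorem hasFDerivAt_simVar_space {p : SpaceTime n} (hp : p.2 < 0) :
    HasFDerivAt (fun y => simVar (y, p.2)) ((1 / (2 * -p.2)) • innerSL ℝ p.1) p.1 := by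
  have h1 := (hasStrictFDerivAt_norm_sq p.1).hasFDerivAt.const_mul (1 / (4 * -p.2))
  have e : (fun y : EuclideanSpace ℝ (Fin n) => simVar (y, p.2))
      = fun y => 1 / (4 * -p.2) * ‖y‖ ^ 2 := by
    funext y; rw [simVar_eq (by exact hp)]; ring
  rw [e]
  refine h1.congr_fderiv ?_
  ext y
  simp
  ring

theorem hasFDerivAt_simSol_space {p : SpaceTime n} (hp : p.2 < 0) (β : ℝ) {F D : ℝ → ℝ}
    (hF : HasDerivAt F (D (simVar p)) (simVar p)) :
    HasFDerivAt (fun y => simSol β F (y, p.2)) (innerSL ℝ (simGrad β D p)) p.1 := by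
  have h1 := (HasDerivAt.comp_hasFDerivAt p.1 (f := fun y => simVar (y, p.2)) hF
    (hasFDerivAt_simVar_space hp)).const_mul ((-p.2) ^ β)
  refine h1.congr_fderiv ?_
  ext y
  simp [simGrad]
  ring

theorem spaceGrad_simSol {p : SpaceTime n} (hp : p.2 < 0) (β : ℝ) {F D : ℝ → ℝ}
    (hF : HasDerivAt F (D (simVar p)) (simVar p)) :
    spaceGrad (simSol β F) p = simGrad β D p := by
  refine HasGradientAt.gradient ?_
  rw [hasGradientAt_iff_hasFDerivAt]
  exact hasFDerivAt_simSol_space hp β hF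

theorem hasDerivAt_simSol_time {p : SpaceTime n} (hp : p.2 < 0) (β : ℝ) {F D : ℝ → ℝ}
    (hF : HasDerivAt F (D (simVar p)) (simVar p)) :
    HasDerivAt (fun τ => simSol β F (p.1, τ))
      ((-p.2) ^ (β - 1) * (simVar p * D (simVar p) - β * F (simVar p))) p.2 := by
  have hp0 : p.2 ≠ 0 := hp.ne
  have hw : HasDerivAt (fun τ => simVar (p.1, τ)) (simVar p / -p.2) p.2 := by
    have h1 := ((hasDerivAt_id p.2).neg.const_mul 4).inv (by simpa using hp0)
    have h2 := h1.const_mul (‖p.1‖ ^ 2)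
    refine (h2.congr_of_eventuallyEq ?_).congr_deriv ?_
    · filter_upwards [Iio_mem_nhds hp] with τ hτ
      rw [simVar_eq (by exact hτ)]; rfl
    · rw [simVar_eq hp]
      simp
      field_simp
  have hr : HasDerivAt (fun τ : ℝ => (-τ) ^ β) (-1 * β * (-p.2) ^ (β - 1)) p.2 :=
    (hasDerivAt_id p.2).neg.rpow_const (Or.inl (by simpa using hp0))
  have h3 := hr.mul (HasDerivAt.comp p.2 (h := fun τ => simVar (p.1, τ)) hF hw)
  refine h3.congr_deriv ?_
  have e : (-p.2) ^ β = (-p.2) ^ (β - 1) * -p.2 := by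
    rw [← Real.rpow_add_one (by simpa using hp0)]; congr 1; ring
  simp only [Function.comp_apply]
  rw [e]
  field_simp
  ring

/-- A component of the space gradient of `simSol β F`. -/
noncomputable def simGradComp (β : ℝ) (D : ℝ → ℝ) (e : EuclideanSpace ℝ (Fin n))
    (p : SpaceTime n) : ℝ :=
  (-p.2) ^ β / (2 * -p.2) * D (simVar p) * inner ℝ p.1 e

theorem inner_simGrad (β : ℝ) (D : ℝ → ℝ) (e : EuclideanSpace ℝ (Fin n)) (p : SpaceTime n) :
    inner ℝ (simGrad β D p) e = simGradComp β D e p := by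
  rw [simGrad, inner_smul_left]; simp [simGradComp]

theorem hasFDerivAt_simGradComp_space {p : SpaceTime n} (hp : p.2 < 0) (β : ℝ) {D D₂ : ℝ → ℝ}
    (hD : HasDerivAt D (D₂ (simVar p)) (simVar p)) (e : EuclideanSpace ℝ (Fin n)) :
    HasFDerivAt (fun y => simGradComp β D e (y, p.2))
      (((-p.2) ^ β / (2 * -p.2)) • (D (simVar p) • innerSL ℝ e +
        (inner ℝ p.1 e * D₂ (simVar p) / (2 * -p.2)) • innerSL ℝ p.1)) p.1 := by
  have h0 : HasFDerivAt (fun y : EuclideanSpace ℝ (Fin n) => inner ℝ y e) (innerSL ℝ e) p.1 := by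
    have := (innerSL ℝ e).hasFDerivAt (x := p.1)
    refine this.congr_of_eventuallyEq (Eventually.of_forall fun y => ?_)
    simp [real_inner_comm]
  have h1 := ((HasDerivAt.comp_hasFDerivAt p.1 (f := fun y => simVar (y, p.2)) hD
    (hasFDerivAt_simVar_space hp)).const_mul ((-p.2) ^ β / (2 * -p.2))).mul h0
  refine h1.congr_fderiv ?_
  ext y
  simp
  ring

/-- The space Laplacian of `simSol β F`, where `D = F'` and `D₂ = F''`. -/
noncomputable def simLap (β : ℝ) (D D₂ : ℝ → ℝ) (p : SpaceTime n) : ℝ :=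
  (-p.2) ^ (β - 1) * (simVar p * D₂ (simVar p) + (n : ℝ) / 2 * D (simVar p))

/-- The trace of the spatial Hessian: the first terms add up to n copies, and Parseval turns the
others into |x|² = 4(-t)w. It serves both the Laplacian and the divergence in the weak equation. -/
theorem sum_simGradComp_deriv {p : SpaceTime n} (hp : p.2 < 0) (β : ℝ) (D D₂ : ℝ → ℝ)
    {ι : Type*} [Fintype ι] (v : OrthonormalBasis ι ℝ (EuclideanSpace ℝ (Fin n))) :
    ∑ i, (((-p.2) ^ β / (2 * -p.2)) • (D (simVar p) • innerSL ℝ (v i) +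
        (inner ℝ p.1 (v i) * D₂ (simVar p) / (2 * -p.2)) • innerSL ℝ p.1)) (v i)
      = simLap β D D₂ p := by
  have hp0 : p.2 ≠ 0 := hp.ne
  have hc : (Fintype.card ι : ℝ) = n := by
    have := Module.finrank_eq_card_basis v.toBasis
    rw [finrank_euclideanSpace_fin] at this
    rw [← this]
  have hs : ∑ i, inner ℝ p.1 (v i) * inner ℝ p.1 (v i) = ‖p.1‖ ^ 2 := by
    rw [← real_inner_self_eq_norm_sq, ← v.sum_inner_mul_inner p.1 p.1]
    exact Finset.sum_congr rfl fun i _ => by rw [real_inner_comm p.1 (v i)]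
  have e1 : ∀ i, (((-p.2) ^ β / (2 * -p.2)) • (D (simVar p) • innerSL ℝ (v i) +
        (inner ℝ p.1 (v i) * D₂ (simVar p) / (2 * -p.2)) • innerSL ℝ p.1)) (v i)
      = ((-p.2) ^ β / (2 * -p.2)) * D (simVar p) + ((-p.2) ^ β / (2 * -p.2)) * D₂ (simVar p)
        / (2 * -p.2) * (inner ℝ p.1 (v i) * inner ℝ p.1 (v i)) := fun i => by
    simp
    ring
  simp only [e1]
  rw [Finset.sum_add_distrib, ← Finset.mul_sum _ _ (_ * _ / _), hs, Finset.sum_const, Finset.card_univ,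
    nsmul_eq_mul, hc, norm_sq_eq_simVar hp, simLap]
  have e : (-p.2) ^ β = (-p.2) ^ (β - 1) * -p.2 := by
    rw [← Real.rpow_add_one (by simpa using hp0)]; congr 1; ring
  rw [e]
  field_simp
  ring

theorem iteratedFDeriv_two_apply_self {E : Type*} [NormedAddCommGroup E] [NormedSpace ℝ E]
    {v A : E → ℝ} {x e : E} {A' : E →L[ℝ] ℝ} (hv : ContDiffAt ℝ 2 v x)
    (h : ∀ᶠ y in 𝓝 x, fderiv ℝ v y e = A y) (hA : HasFDerivAt A A' x) :
    iteratedFDeriv ℝ 2 v x ![e, e] = A' e := by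
  have h1 : DifferentiableAt ℝ (fderiv ℝ v) x :=
    (hv.fderiv_right (m := 1) (by norm_num)).differentiableAt (by norm_num)
  have h2 : HasFDerivAt (fun y => fderiv ℝ v y e) ((fderiv ℝ (fderiv ℝ v) x).flip e) x := by
    have := h1.hasFDerivAt.clm_apply (hasFDerivAt_const e x)
    simpa using this
  have h3 := (h2.congr_of_eventuallyEq (h.mono fun y hy => hy.symm)).unique hA
  rw [iteratedFDeriv_two_apply, ← h3]
  simp

theorem spaceLaplacian_simSol {p : SpaceTime n} (hp : p.2 < 0) (β : ℝ) {F D D₂ : ℝ → ℝ}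
    (hF : ∀ w, HasDerivAt F (D w) w) (hF2 : ContDiffAt ℝ 2 F (simVar p))
    (hD : HasDerivAt D (D₂ (simVar p)) (simVar p)) :
    spaceLaplacian (simSol β F) p = simLap β D D₂ p := by
  have hv : ContDiffAt ℝ 2 (fun y => simSol β F (y, p.2)) p.1 :=
    (contDiffAt_simSol (m := 2) hp β hF2).comp p.1 (contDiffAt_id.prodMk contDiffAt_const)
  rw [spaceLaplacian, InnerProductSpace.laplacian_eq_iteratedFDeriv_orthonormalBasis _
    (stdOrthonormalBasis ℝ (EuclideanSpace ℝ (Fin n))),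
    ← sum_simGradComp_deriv hp β D D₂ (stdOrthonormalBasis ℝ (EuclideanSpace ℝ (Fin n)))]
  refine Finset.sum_congr rfl fun i _ => ?_
  refine iteratedFDeriv_two_apply_self hv (Eventually.of_forall fun y => ?_)
    (hasFDerivAt_simGradComp_space hp β hD _)
  rw [(hasFDerivAt_simSol_space (p := (y, p.2)) hp β (hF _)).fderiv, innerSL_apply_apply,
    inner_simGrad]

end SelfSimilar

/-! ### The classical solution and the failure of the Lipschitz bound -/

section Solutions

variable {n : ℕ} {β ε w₀ : ℝ} {F D D₂ : ℝ → ℝ}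

theorem simVar_lt_of_simSol_pos {b : ℝ} (hF : IsTwoPhaseProfile b β ε w₀ F D D₂)
    {p : SpaceTime n} (hp : p.2 < 0) (h : 0 < simSol β F p) : simVar p < w₀ := by
  have h1 : 0 < F (simVar p) := (pos_iff_pos_of_mul_pos h).1 (Real.rpow_pos_of_pos (by linarith) _)
  by_contra! h2
  rcases h2.eq_or_lt with h2 | h2
  · rw [← h2, hF.value_eq] at h1; exact lt_irrefl _ h1
  · exact (hF.value_neg _ h2).not_gt h1

theorem lt_simVar_of_simSol_neg {b : ℝ} (hF : IsTwoPhaseProfile b β ε w₀ F D D₂)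
    {p : SpaceTime n} (hp : p.2 < 0) (h : simSol β F p < 0) : w₀ < simVar p := by
  have h0 : 0 < (-p.2) ^ β := Real.rpow_pos_of_pos (by linarith) _
  by_contra! h2
  rcases h2.eq_or_lt with h2 | h2
  · rw [simSol, h2, hF.value_eq, mul_zero] at h; exact lt_irrefl _ h
  · exact (mul_pos h0 (hF.value_pos _ (simVar_nonneg p) h2)).not_gt h

theorem contDiffAt_one_simSol {b : ℝ} (hF : IsTwoPhaseProfile b β ε w₀ F D D₂)
    {p : SpaceTime n} (hp : p.2 < 0) : ContDiffAt ℝ 1 (simSol β F) p :=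
  contDiffAt_simSol (m := 1) hp β hF.contDiff.contDiffAt

theorem continuousAt_simGrad (hD : Continuous D) {p : SpaceTime n} (hp : p.2 < 0) :
    ContinuousAt (simGrad β D) p := by
  have h1 := (contDiffAt_neg_time_rpow hp β 0).continuousAt
  have h2 := (contDiffAt_simVar hp 0).continuousAt
  exact ((h1.div (by fun_prop) (by linarith)).mul (hD.continuousAt.comp h2)).smul continuousAt_fst

/-- Up to the factor (-t)^{β-1}, the heat equation is the profile equation at w = `simVar p`. -/
theorem time_deriv_eq_simLap_pos (hF : IsTwoPhaseProfile ((n : ℝ) / 2) β ε w₀ F D D₂)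
    {p : SpaceTime n} (h : simVar p < w₀) :
    (-p.2) ^ (β - 1) * (simVar p * D (simVar p) - β * F (simVar p)) = simLap β D D₂ p := by
  have := hF.ode_pos _ (simVar_nonneg p) h
  rw [simLap]
  linear_combination (-(-p.2) ^ (β - 1)) * this

theorem time_deriv_eq_simLap_neg (hF : IsTwoPhaseProfile ((n : ℝ) / 2) β ε w₀ F D D₂)
    {p : SpaceTime n} (h : w₀ < simVar p) :
    ε * ((-p.2) ^ (β - 1) * (simVar p * D (simVar p) - β * F (simVar p))) = simLap β D D₂ p := by
  have := hF.ode_neg _ h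
  rw [simLap]
  linear_combination (-(-p.2) ^ (β - 1)) * this

theorem isOpen_past : IsOpen ((univ : Set (EuclideanSpace ℝ (Fin n))) ×ˢ Iio (0 : ℝ)) :=
  isOpen_univ.prod isOpen_Iio

theorem isClassicalSolution_simSol (hF : IsTwoPhaseProfile ((n : ℝ) / 2) β ε w₀ F D D₂) :
    IsClassicalSolution (n := n) 1 ε (univ ×ˢ Iio 0) (simSol β F) := by
  refine ⟨fun p hp => (contDiffAt_one_simSol hF hp.2).continuousAt.continuousWithinAt, ?_, ?_, ?_⟩
  · intro p hp h
    have hw := simVar_lt_of_simSol_pos hF hp.2 h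
    refine ⟨contDiffAt_simSol (m := 2) hp.2 β (hF.contDiffAt _ hw.ne), ?_⟩
    rw [spaceLaplacian_simSol hp.2 β hF.hasDerivAt (hF.contDiffAt _ hw.ne)
      (hF.hasDerivAt_deriv _ hw.ne), timeDeriv, (hasDerivAt_simSol_time hp.2 β (hF.hasDerivAt _)).deriv,
      one_mul, time_deriv_eq_simLap_pos hF hw]
  · intro p hp h
    have hw := lt_simVar_of_simSol_neg hF hp.2 h
    refine ⟨contDiffAt_simSol (m := 2) hp.2 β (hF.contDiffAt _ hw.ne'), ?_⟩
    rw [spaceLaplacian_simSol hp.2 β hF.hasDerivAt (hF.contDiffAt _ hw.ne')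
      (hF.hasDerivAt_deriv _ hw.ne'), timeDeriv, (hasDerivAt_simSol_time hp.2 β (hF.hasDerivAt _)).deriv,
      time_deriv_eq_simLap_neg hF hw]
  · intro p hp _
    -- The gradient is continuous across the interface, so both one-phase limits are its value at p.
    have h1 : Tendsto (spaceGrad (simSol β F)) (𝓝 p) (𝓝 (simGrad β D p)) := by
      refine Tendsto.congr' ?_ (continuousAt_simGrad (β := β) hF.continuous_deriv hp.2)
      filter_upwards [isOpen_past.mem_nhds hp] with q hq
      exact (spaceGrad_simSol hq.2 β (hF.hasDerivAt _)).symm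
    exact ⟨_, h1.mono_left nhdsWithin_le_nhds, h1.mono_left nhdsWithin_le_nhds⟩

/-- At time -τ compare the origin, where u = τ^β, with a point at distance 2√w₀√τ, where u = 0. The
difference quotient is a constant times τ^{β-1/2}, which is unbounded. -/
theorem not_isSpaceLipschitzOn_simSol (hn : 0 < n) {b : ℝ} (hF : IsTwoPhaseProfile b β ε w₀ F D D₂)
    (hβ : β < 1 / 2) {r : ℝ} (hr : 0 < r) :
    ¬ IsSpaceLipschitzOn (n := n) (Metric.ball 0 r ×ˢ Ioo (-r ^ 2) 0) (simSol β F) := by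
  rintro ⟨L, hL⟩
  have hw := hF.pos
  set e : EuclideanSpace ℝ (Fin n) := EuclideanSpace.single ⟨0, hn⟩ 1
  have he : ‖e‖ = 1 := by simp [e]
  have hτ : ∀ᶠ τ in 𝓝[>] (0 : ℝ), τ ^ (β - 1 / 2) ≤ L * (2 * √w₀) := by
    have h1 : ∀ᶠ τ : ℝ in 𝓝[>] 0, 2 * √w₀ * √τ < r := by
      have : Tendsto (fun τ : ℝ => 2 * √w₀ * √τ) (𝓝 0) (𝓝 (2 * √w₀ * √0)) :=
        (by fun_prop : Continuous fun τ : ℝ => 2 * √w₀ * √τ).tendsto 0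
      rw [Real.sqrt_zero, mul_zero] at this
      exact (this.eventually (gt_mem_nhds hr)).filter_mono nhdsWithin_le_nhds
    filter_upwards [h1, Ioo_mem_nhdsGT (pow_pos hr 2)] with τ h1 h2
    have h0 : 0 < 2 * √w₀ * √τ := by have := Real.sqrt_pos.2 hw; have := Real.sqrt_pos.2 h2.1; positivity
    have hx : ‖(2 * √w₀ * √τ) • e‖ = 2 * √w₀ * √τ := by
      rw [norm_smul, he, mul_one, Real.norm_of_nonneg h0.le]
    have h3 := hL 0 ((2 * √w₀ * √τ) • e) (-τ)
      ⟨by simpa using hr, by constructor <;> simp only <;> linarith [h2.1, h2.2]⟩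
      ⟨by rw [mem_ball_zero_iff]; simpa only [hx] using h1,
        by constructor <;> simp only <;> linarith [h2.1, h2.2]⟩
    have v1 : simSol (n := n) β F (0, -τ) = τ ^ β := by
      simp [simSol, simVar, hF.value_zero]
    have v2 : simSol (n := n) β F ((2 * √w₀ * √τ) • e, -τ) = 0 := by
      have : simVar (n := n) ((2 * √w₀ * √τ) • e, -τ) = w₀ := by
        simp only [simVar, hx, neg_neg]
        have := (Real.sqrt_pos.2 h2.1).ne'
        field_simp
        rw [Real.sq_sqrt hw.le]; ring
      rw [simSol, this, hF.value_eq, mul_zero]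
    rw [v1, v2, sub_zero, zero_sub, norm_neg, hx, abs_of_pos (Real.rpow_pos_of_pos h2.1 _)] at h3
    rw [Real.rpow_sub h2.1, ← Real.sqrt_eq_rpow, div_le_iff₀ (Real.sqrt_pos.2 h2.1)]
    linarith
  have hinf : Tendsto (fun τ : ℝ => τ ^ (β - 1 / 2)) (𝓝[>] 0) atTop :=
    tendsto_rpow_neg_nhdsGT_zero (by linarith)
  obtain ⟨τ, h1, h2⟩ := (hτ.and (hinf.eventually_gt_atTop (L * (2 * √w₀)))).exists
  linarith

end Solutions

/-! ## Integration by parts -/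

/-- On a compact neighbourhood of the support A is Lipschitz and extends to a globally Lipschitz g.
Replacing A by g changes neither integrand and allows integration by parts for Lipschitz functions.
-/
theorem integral_lineDeriv_mul_of_lipschitzNear {E : Type*} [NormedAddCommGroup E]
    [NormedSpace ℝ E] [FiniteDimensional ℝ E] [MeasurableSpace E] [BorelSpace E] (μ : Measure E)
    [μ.IsAddHaarMeasure] {Ω : Set E} (hΩ : IsOpen Ω) {A φ : E → ℝ}
    (hA : ∀ p ∈ Ω, LipschitzNear A p) (hφ : ContDiff ℝ 1 φ) (hc : HasCompactSupport φ)
    (hs : tsupport φ ⊆ Ω) (v : E) :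
    Integrable (fun p => A p * lineDeriv ℝ φ p v) μ ∧
    Integrable (fun p => lineDeriv ℝ A p v * φ p) μ ∧
    ∫ p, A p * lineDeriv ℝ φ p v ∂μ = - ∫ p, lineDeriv ℝ A p v * φ p ∂μ := by
  -- A thickening, not just the support, is needed: A and g must agree near each support point to
  -- share line derivatives.
  obtain ⟨δ, hδ, hδΩ⟩ := hc.isCompact.exists_cthickening_subset_open hΩ hs
  set K := Metric.cthickening δ (tsupport φ) with hK
  have hKc : IsCompact K := hc.isCompact.cthickening
  have hKn : ∀ p ∈ tsupport φ, K ∈ 𝓝 p := fun p hp =>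
    mem_of_superset (Metric.isOpen_thickening.mem_nhds (Metric.self_subset_thickening hδ _ hp))
      (Metric.thickening_subset_cthickening _ _)
  have hloc : LocallyLipschitzOn K A := fun p hp => by
    obtain ⟨C, t, ht, h⟩ := hA p (hδΩ hp)
    exact ⟨C, t, mem_nhdsWithin_of_mem_nhds ht, h⟩
  obtain ⟨C, hC⟩ := hloc.exists_lipschitzOnWith_of_compact hKc
  obtain ⟨g, hg, hgA⟩ := hC.extend_real
  have e1 : ∀ p, g p * lineDeriv ℝ φ p v = A p * lineDeriv ℝ φ p v := fun p => by
    by_cases hp : p ∈ tsupport φ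
    · rw [hgA (mem_of_mem_nhds (hKn p hp))]
    · have : lineDeriv ℝ φ p v = 0 := by
        have h0 : φ =ᶠ[𝓝 p] fun _ => 0 := notMem_tsupport_iff_eventuallyEq.1 hp
        rw [h0.lineDeriv_eq]; simp [lineDeriv]
      rw [this, mul_zero, mul_zero]
  have e2 : ∀ p, lineDeriv ℝ g p v * φ p = lineDeriv ℝ A p v * φ p := fun p => by
    by_cases hp : p ∈ tsupport φ
    · have : A =ᶠ[𝓝 p] g := by filter_upwards [hKn p hp] with q hq using hgA hq
      rw [this.lineDeriv_eq]
    · rw [image_eq_zero_of_notMem_tsupport hp, mul_zero, mul_zero]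
  have hd : ∀ p, lineDeriv ℝ φ p v = fderiv ℝ φ p v := fun p =>
    (hφ.differentiable one_ne_zero p).lineDeriv_eq_fderiv
  have hcd : Continuous fun p => lineDeriv ℝ φ p v := by
    simp only [hd]; exact (hφ.continuous_fderiv one_ne_zero).clm_apply continuous_const
  have hcs : HasCompactSupport fun p => lineDeriv ℝ φ p v := by
    simp only [hd]; exact hc.fderiv_apply (𝕜 := ℝ) v
  obtain ⟨C', hφL⟩ := hφ.lipschitzWith_of_hasCompactSupport hc one_ne_zero
  simp only [← e1, ← e2]
  refine ⟨(hg.continuous.mul hcd).integrable_of_hasCompactSupport hcs.mul_left, ?_, ?_⟩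
  · have := (hg.locallyIntegrable_lineDeriv (μ := μ) v).integrable_smul_right_of_hasCompactSupport
      hφ.continuous hc
    exact this
  · rw [hg.integral_lineDeriv_mul_eq hφL hc v, ← integral_neg]
    refine integral_congr_ae (Eventually.of_forall fun p => ?_)
    simp only [lineDeriv_neg]
    ring

/-! ## Weak solutions -/

section Weak

variable {n : ℕ}

instance isAddHaarMeasure_volume_spaceTime :
    (volume : Measure (SpaceTime n)).IsAddHaarMeasure :=
  inferInstanceAs (Measure.prod volume volume).IsAddHaarMeasure

theorem hasLineDerivAt_space {f : SpaceTime n → ℝ} {p : SpaceTime n}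
    {L : EuclideanSpace ℝ (Fin n) →L[ℝ] ℝ} (h : HasFDerivAt (fun y => f (y, p.2)) L p.1)
    (e : EuclideanSpace ℝ (Fin n)) : HasLineDerivAt ℝ f (L e) p (e, 0) := by
  have := h.hasLineDerivAt e
  unfold HasLineDerivAt at this ⊢
  refine this.congr_of_eventuallyEq (Eventually.of_forall fun s => congrArg f ?_)
  ext <;> simp

theorem hasLineDerivAt_time {f : SpaceTime n → ℝ} {p : SpaceTime n} {d : ℝ}
    (h : HasDerivAt (fun τ => f (p.1, τ)) d p.2) : HasLineDerivAt ℝ f d p (0, 1) := by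
  unfold HasLineDerivAt
  have h1 : HasDerivAt (fun s : ℝ => p.2 + s) 1 0 := (hasDerivAt_id (0 : ℝ)).const_add p.2
  have h2 := HasDerivAt.comp (0 : ℝ) (h := fun s : ℝ => p.2 + s) (h₂ := fun τ => f (p.1, τ))
    (by simpa using h) h1
  rw [mul_one] at h2
  refine h2.congr_of_eventuallyEq (Eventually.of_forall fun s => congrArg f ?_)
  ext <;> simp

theorem inner_spaceGrad_eq_lineDeriv {φ : SpaceTime n → ℝ} (hφ : Differentiable ℝ φ)
    (p : SpaceTime n) (e : EuclideanSpace ℝ (Fin n)) :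
    inner ℝ (spaceGrad φ p) e = lineDeriv ℝ φ p (e, 0) := by
  have h : DifferentiableAt ℝ (fun y => φ (y, p.2)) p.1 := by fun_prop
  rw [spaceGrad, inner_gradient_left, (hasLineDerivAt_space h.hasFDerivAt e).lineDeriv]

theorem timeDeriv_eq_lineDeriv {φ : SpaceTime n → ℝ} (hφ : Differentiable ℝ φ)
    (p : SpaceTime n) : timeDeriv φ p = lineDeriv ℝ φ p (0, 1) := by
  have h : DifferentiableAt ℝ (fun τ => φ (p.1, τ)) p.2 := by fun_prop
  rw [timeDeriv, (hasLineDerivAt_time h.hasDerivAt).lineDeriv]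

/-- For fixed x at most one time t lies on the paraboloid |x|² = 4w₀(-t), so Fubini applies. -/
theorem ae_simVar_ne {w₀ : ℝ} (hw : 0 < w₀) :
    ∀ᵐ p : SpaceTime n, p.2 < 0 → simVar p ≠ w₀ := by
  set S : Set (SpaceTime n) := {p | ‖p.1‖ ^ 2 = w₀ * (4 * -p.2)} with hS
  have hSm : MeasurableSet S := (isClosed_eq (by fun_prop) (by fun_prop)).measurableSet
  have hS0 : (volume : Measure (SpaceTime n)) S = 0 := by
    rw [Measure.volume_eq_prod]
    refine Measure.measure_prod_null_of_ae_null hSm (Eventually.of_forall fun x => ?_)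
    refine Set.Subsingleton.measure_zero (fun t ht s hs => ?_) _
    have h1 : ‖x‖ ^ 2 = w₀ * (4 * -t) := ht
    have h2 : ‖x‖ ^ 2 = w₀ * (4 * -s) := hs
    have := mul_left_cancel₀ hw.ne' (h1.symm.trans h2)
    linarith
  filter_upwards [measure_eq_zero_iff_ae_notMem.1 hS0] with p hp hp0 he
  exact hp (by rw [hS, mem_ofPred_eq, norm_sq_eq_simVar hp0, he])

variable {β ε w₀ : ℝ} {F D D₂ : ℝ → ℝ}

theorem lipschitzNear_simSol {b : ℝ} (hF : IsTwoPhaseProfile b β ε w₀ F D D₂) {p : SpaceTime n}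
    (hp : p.2 < 0) : LipschitzNear (simSol (n := n) β F) p :=
  (contDiffAt_one_simSol hF hp).lipschitzNear

theorem lipschitzNear_simGradComp (hD : ∀ w, LipschitzNear D w) {p : SpaceTime n} (hp : p.2 < 0)
    (e : EuclideanSpace ℝ (Fin n)) : LipschitzNear (simGradComp β D e) p := by
  have h1 : ContDiffAt ℝ 1 (fun p : SpaceTime n => (-p.2) ^ β / (2 * -p.2)) p :=
    (contDiffAt_neg_time_rpow hp β 1).div (by fun_prop) (by linarith)
  have h2 : ContDiffAt ℝ 1 (fun p : SpaceTime n => inner ℝ p.1 e) p :=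
    contDiffAt_fst.inner ℝ contDiffAt_const
  exact (h1.lipschitzNear.mul ((hD _).comp (contDiffAt_simVar hp 1).lipschitzNear)).mul
    h2.lipschitzNear

theorem lipschitzNear_phaseC (aP aM : ℝ) (s : ℝ) : LipschitzNear (phaseC aP aM) s := by
  have hp : LipschitzNear (fun s : ℝ => max s 0) s :=
    (LipschitzWith.id.max_const 0).lipschitzNear s
  have hm : LipschitzNear (fun s : ℝ => max (-s) 0) s :=
    (LipschitzWith.id.neg.max_const 0).lipschitzNear s
  refine LipschitzNear.congr (f := fun s => aP * max s 0 + (-aM) * max (-s) 0)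
    ((((LipschitzWith.const aP).lipschitzNear s).mul hp).add
      (((LipschitzWith.const (-aM)).lipschitzNear s).mul hm))
    (Eventually.of_forall fun x => by simp only [phaseC]; ring)

/-- Near a point off the interface c(u) is u or εu, and either phase equation gives the same
expression `simLap`, which is also the divergence of the gradient. -/
theorem lineDeriv_phaseC_simSol (hF : IsTwoPhaseProfile ((n : ℝ) / 2) β ε w₀ F D D₂)
    {p : SpaceTime n} (hp : p.2 < 0) (hw : simVar p ≠ w₀) :
    lineDeriv ℝ (fun q => phaseC 1 ε (simSol β F q)) p (0, 1) = simLap β D D₂ p := by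
  have h0 : 0 < (-p.2) ^ β := Real.rpow_pos_of_pos (by linarith) _
  have hc := (lipschitzNear_simSol hF hp).continuousAt
  have hd := hasLineDerivAt_time (f := simSol β F) (hasDerivAt_simSol_time hp β (hF.hasDerivAt _))
  rcases lt_or_gt_of_ne hw with h | h
  · have hpos : 0 < simSol β F p := mul_pos h0 (hF.value_pos _ (simVar_nonneg p) h)
    have he : (fun q => phaseC 1 ε (simSol β F q)) =ᶠ[𝓝 p] simSol β F := by
      filter_upwards [hc.eventually (lt_mem_nhds hpos)] with q hq
      rw [phaseC, max_eq_left hq.le, max_eq_right (by linarith)]; ring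
    rw [he.lineDeriv_eq, hd.lineDeriv, time_deriv_eq_simLap_pos hF h]
  · have hneg : simSol β F p < 0 := mul_neg_of_pos_of_neg h0 (hF.value_neg _ h)
    have he : (fun q => phaseC 1 ε (simSol β F q)) =ᶠ[𝓝 p] fun q => ε • simSol β F q := by
      filter_upwards [hc.eventually (gt_mem_nhds hneg)] with q hq
      rw [phaseC, max_eq_right hq.le, max_eq_left (by linarith), smul_eq_mul]; ring
    have hd' : HasLineDerivAt ℝ (fun q => ε • simSol β F q)
        (ε • ((-p.2) ^ (β - 1) * (simVar p * D (simVar p) - β * F (simVar p)))) p (0, 1) :=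
      HasDerivAt.const_smul ε hd
    rw [he.lineDeriv_eq, hd'.lineDeriv, smul_eq_mul, time_deriv_eq_simLap_neg hF h]

theorem sum_lineDeriv_simGradComp (hF : IsTwoPhaseProfile ((n : ℝ) / 2) β ε w₀ F D D₂)
    {p : SpaceTime n} (hp : p.2 < 0) (hw : simVar p ≠ w₀) {ι : Type*} [Fintype ι]
    (v : OrthonormalBasis ι ℝ (EuclideanSpace ℝ (Fin n))) :
    ∑ i, lineDeriv ℝ (simGradComp β D (v i)) p (v i, 0) = simLap β D D₂ p := by
  rw [← sum_simGradComp_deriv hp β D D₂ v]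
  exact Finset.sum_congr rfl fun i _ => (hasLineDerivAt_space
    (hasFDerivAt_simGradComp_space hp β (hF.hasDerivAt_deriv _ hw) (v i)) (v i)).lineDeriv

theorem isWeakSpaceGrad_simSol {b : ℝ} (hF : IsTwoPhaseProfile b β ε w₀ F D D₂) :
    IsWeakSpaceGrad (n := n) (univ ×ˢ Iio 0) (simSol β F) (simGrad β D) := by
  refine ⟨fun K hK hKΩ => ?_, fun φ hφ e => ?_⟩
  · have hc : ContinuousOn (simGrad (n := n) β D) K := fun p hp =>
      (continuousAt_simGrad hF.continuous_deriv (hKΩ hp).2).continuousWithinAt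
    obtain ⟨C, hC⟩ := hK.exists_bound_of_continuousOn hc
    have : IsFiniteMeasure ((volume : Measure (SpaceTime n)).restrict K) :=
      isFiniteMeasure_restrict.2 hK.measure_lt_top.ne
    exact MemLp.of_bound (hc.aestronglyMeasurable hK.measurableSet) C
      ((ae_restrict_iff' hK.measurableSet).2 (Eventually.of_forall hC))
  · have hφ1 : ContDiff ℝ 1 φ := hφ.1.of_le (by norm_cast)
    simp only [inner_spaceGrad_eq_lineDeriv (hφ1.differentiable one_ne_zero)]
    rw [(integral_lineDeriv_mul_of_lipschitzNear volume isOpen_past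
      (fun p hp => lipschitzNear_simSol hF hp.2) hφ1 hφ.2.1 hφ.2.2 (e, 0)).2.2]
    congr 1
    refine integral_congr_ae (Eventually.of_forall fun p => ?_)
    by_cases hp : p ∈ tsupport φ
    · have := (hasLineDerivAt_space (hasFDerivAt_simSol_space (hφ.2.2 hp).2 β (hF.hasDerivAt _))
        e).lineDeriv
      simp only [this, innerSL_apply_apply]
    · simp only [image_eq_zero_of_notMem_tsupport hp, mul_zero]

/-- Moving all derivatives off φ leaves the integral of (div G - ∂ₜc(u))φ, and the bracket vanishes
almost everywhere on the support. -/
theorem isWeakSolution_simSol (hF : IsTwoPhaseProfile ((n : ℝ) / 2) β ε w₀ F D D₂) :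
    IsWeakSolution (n := n) 1 ε (univ ×ˢ Iio 0) (simSol β F) := by
  refine ⟨fun p hp => (contDiffAt_one_simSol hF hp.2).continuousAt.continuousWithinAt,
    simGrad β D, isWeakSpaceGrad_simSol hF, fun φ hφ => ?_⟩
  have hφ1 : ContDiff ℝ 1 φ := hφ.1.of_le (by norm_cast)
  have hφd := hφ1.differentiable one_ne_zero
  set v := stdOrthonormalBasis ℝ (EuclideanSpace ℝ (Fin n))
  have hin : ∀ p, inner ℝ (simGrad β D p) (spaceGrad φ p)
      = ∑ i, simGradComp β D (v i) p * lineDeriv ℝ φ p (v i, 0) := fun p => by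
    rw [← v.sum_inner_mul_inner]
    refine Finset.sum_congr rfl fun i _ => ?_
    rw [inner_simGrad, real_inner_comm, inner_spaceGrad_eq_lineDeriv hφd]
  obtain ⟨t1, t2, t3⟩ := integral_lineDeriv_mul_of_lipschitzNear volume isOpen_past
    (A := fun q => phaseC 1 ε (simSol β F q))
    (fun p hp => (lipschitzNear_phaseC 1 ε _).comp (lipschitzNear_simSol hF hp.2))
    hφ1 hφ.2.1 hφ.2.2 (0, 1)
  have hs := fun i => integral_lineDeriv_mul_of_lipschitzNear volume isOpen_past
    (A := simGradComp β D (v i)) (fun p hp => lipschitzNear_simGradComp hF.lipschitzNear hp.2 (v i))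
    hφ1 hφ.2.1 hφ.2.2 (v i, 0)
  simp only [hin, timeDeriv_eq_lineDeriv hφd]
  rw [integral_sub t1 (integrable_finsetSum _ fun i _ => (hs i).1),
    integral_finsetSum _ fun i _ => (hs i).1, t3]
  simp only [(hs _).2.2]
  rw [Finset.sum_neg_distrib, ← integral_finsetSum _ fun i _ => (hs i).2.1, sub_neg_eq_add,
    neg_add_eq_zero]
  refine integral_congr_ae ?_
  filter_upwards [ae_simVar_ne (n := n) hF.pos] with p hne
  by_cases hp : p ∈ tsupport φ
  · have hp0 : p.2 < 0 := (hφ.2.2 hp).2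
    rw [lineDeriv_phaseC_simSol hF hp0 (hne hp0), ← Finset.sum_mul,
      sum_lineDeriv_simGradComp hF hp0 (hne hp0) v]
  · simp only [image_eq_zero_of_notMem_tsupport hp, mul_zero, Finset.sum_const_zero]

end Weak

theorem theorem8p2 (n : ℕ) (hn : 3 ≤ n) :
    ∃ ε₀ : ℝ, 0 < ε₀ ∧ ε₀ < 1 ∧ ∃ α : ℝ → ℝ,
      (∀ ε : ℝ, 0 < ε → ε < ε₀ →
        0 < α ε ∧ α ε < 1 ∧
        ∃ s₀ : ℝ,
          IsUniquePosZero (fun s => kummerM (-(α ε) / 2) ((n : ℝ) / 2) (s ^ 2 / 4)) s₀ ∧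
          IsUniquePosZero (fun s => tricomiU (-(α ε) / 2) ((n : ℝ) / 2) (ε * s ^ 2 / 4)) s₀ ∧
          ∃ κ : ℝ, 0 < κ ∧
            IsProfileSolution n (α ε) ε (profile n (α ε) ε κ s₀) ∧
            IsClassicalSolution 1 ε (univ ×ˢ Iio 0)
              (selfSimilar n (α ε) (profile n (α ε) ε κ s₀)) ∧
            IsWeakSolution 1 ε (univ ×ˢ Iio 0)
              (selfSimilar n (α ε) (profile n (α ε) ε κ s₀)) ∧
            ∀ r : ℝ, 0 < r →
              ¬ IsSpaceLipschitzOn (Metric.ball 0 r ×ˢ Ioo (-r ^ 2) 0)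
                (selfSimilar n (α ε) (profile n (α ε) ε κ s₀))) ∧
      Tendsto α (𝓝[>] 0) (𝓝 0) := by
  have hb : (1 : ℝ) ≤ (n : ℝ) / 2 := by
    have : (3 : ℝ) ≤ n := by exact_mod_cast hn
    linarith
  obtain ⟨ε₀, h0, h1, β, hβ, hlim⟩ := exists_matching_exponent hb
  refine ⟨ε₀, h0, h1, fun ε => 2 * β ε, fun ε hε hε' => ?_, by simpa using hlim.const_mul 2⟩
  obtain ⟨hβ0, hβ1, w₀, hw, hM, hW⟩ := hβ ε hε hε'
  have hβ' : β ε < 1 := by linarith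
  obtain ⟨K, hK, hF⟩ := isTwoPhaseProfile_glue hb hβ0 hβ' hε hw hM hW
  have ea : -(2 * β ε) / 2 = -β ε := by ring
  have ea' : 2 * β ε / 2 = β ε := by ring
  have hG : 0 < Real.Gamma (1 - β ε) := Real.Gamma_pos_of_pos (by linarith)
  have hs : (2 * √w₀) ^ 2 / 4 = w₀ := by rw [mul_pow, Real.sq_sqrt hw.le]; ring
  have hs0 : 0 < 2 * √w₀ := by have := Real.sqrt_pos.2 hw; linarith
  have huniq : ∀ s : ℝ, 0 < s → s ^ 2 / 4 = w₀ → s = 2 * √w₀ := fun s h e => by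
    rw [← hs] at e
    exact (pow_left_inj₀ h.le hs0.le two_ne_zero).1 (by linarith)
  -- The factor Γ(1-β) in κ undoes the normalisation of `tricomiW`.
  have hprof : ∀ s, 0 ≤ s → profile n (2 * β ε) ε (K * Real.Gamma (1 - β ε)) (2 * √w₀) s
      = glue w₀ (kummerM (-β ε) (n / 2)) (fun w => -K * tricomiW (β ε) (n / 2) (ε * w))
        (s ^ 2 / 4) := fun s h => by
    have hiff : s ≤ 2 * √w₀ ↔ s ^ 2 / 4 ≤ w₀ := by
      rw [← pow_le_pow_iff_left₀ h hs0.le two_ne_zero]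
      constructor <;> intro h' <;> linarith
    simp only [profile, glue, hiff, ea, tricomiU_neg_eq hβ0.le hβ']
    rw [mul_div_assoc ε]
    congr 1
    field_simp
  simp only [ea]
  refine ⟨by linarith, by linarith, 2 * √w₀, ⟨hs0, ?_, fun s h e => huniq s h ?_⟩,
    ⟨hs0, ?_, fun s h e => huniq s h ?_⟩, K * Real.Gamma (1 - β ε), mul_pos hK hG, ?_⟩
  · simp only [hs, hM]
  · exact (strictAntiOn_kummerM hb hβ0 hβ').injOn (mem_Ici.2 (by positivity)) hw.le (e.trans hM.symm)
  · simp only [tricomiU_neg_eq hβ0.le hβ', mul_div_assoc ε, hs, hW, mul_zero]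
  · simp only [tricomiU_neg_eq hβ0.le hβ', mul_div_assoc ε] at e
    have e' := (mul_eq_zero.1 e).resolve_left (inv_ne_zero hG.ne')
    have := (strictMonoOn_tricomiW (b := (n : ℝ) / 2) hβ0 hβ').injOn
      (mem_Ioi.2 (by positivity)) (mem_Ioi.2 (by positivity)) (e'.trans hW.symm)
    exact mul_left_cancel₀ hε.ne' this
  · rw [selfSimilar_eq_simSol hprof, ea']
    exact ⟨IsTwoPhaseProfile.isProfileSolution (by rw [ea']; exact hF) hprof,
      isClassicalSolution_simSol hF, isWeakSolution_simSol hF,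
      fun r hr => not_isSpaceLipschitzOn_simSol (by omega) hF (by linarith) hr⟩
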